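/- For $k\ge 1$ let $e_{n_k}(t)=(2\pi)^{-1/2}e^{i n_k t}$, where $(n_k)_{k\ge1}=(0,-1,1,-2,2,\dots)$, and let $\mathcal T=\{e_{n_k}\}_{k\ge1}$ be the trigonometric system in its natural ordering. For a measurable $2\pi$-periodic weight $w:\mathbb R\to[0,\infty]$ and $1<p<\infty$ let $L^p(\mathbb T;w)$ be the Banach space of (classes of) measurable $f:[-\pi,\pi)\to\mathbb C$ with $\|f\|_{p,w}^p=\int_{-\pi}^{\pi}|f(t)|^p\,w(t)\,dt<\infty$. A bounded Schauder basis of a complex Banach space $X$ is a Schauder basis $(b_k)_{k\ge1}$ with coordinate functionals $(b_k^*)$ such that $0<\inf_k\|b_k\|\le\sup_k\|b_k\|<\infty$. For $x\in X$ let $\rho:\mathbb N\to\mathbb N$ be a greedy ordering of its coefficients: $\rho(\mathbb N)\supseteq\{j:b_j^*(x)\ne0\}$ and, for $j<k$, either $|b^*_{\rho(k)}(x)|<|b^*_{\rho(j)}(x)|$, or $|b^*_{\rho(k)}(x)|=|b^*_{\rho(j)}(x)|$ and $\rho(k)>\rho(j)$. Put $\mathcal G_m(x)=\sum_{j=1}^m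 b^*_{\rho(j)}(x)\,b_{\rho(j)}$. The basis is called quasi-greedy if $\lim_{m\to\infty}\|x-\mathcal G_m(x)\|=0$ for every $x\in X$. The weight $w$ is an $A_2$-weight if there is $K<\infty$ such that for every bounded interval $I\subset\mathbb R$ of positive length $$\Big(\frac1{|I|}\int_I w(t)\,dt\Big)\Big(\frac1{|I|}\int_I w(t)^{-1}\,dt\Big)\le K,$$ with the convention $0\cdot\infty=0$. Theorem. Let $w:\mathbb R\to[0,\infty]$ be a measurable $2\pi$-periodic weight and $1<p<\infty$. Suppose that $\mathcal T$ is contained in $L^p(\mathbb T;w)$ and is a quasi-greedy basis for $L^p(\mathbb T;w)$. Then $p=2$, $w$ is an $A_2$-weight, and there exists a constant $C>0$ such that $C^{-1}\le w(t)\le C$ for almost every $t$. -/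

import Mathlib

open MeasureTheory Filter Topology
open scoped ENNReal NNReal

/-! ### Greedy approximation with respect to a Schauder basis -/

/-- `ρ` is a greedy ordering of the coefficient sequence `c`: it enumerates (at least) the support
of `c` by decreasing modulus, ties being broken by increasing index. -/
def IsGreedyOrdering (c : ℕ → ℂ) (ρ : ℕ → ℕ) : Prop :=
  {j | c j ≠ 0} ⊆ Set.range ρ ∧
    ∀ j k, j < k → ‖c (ρ k)‖ < ‖c (ρ j)‖ ∨ (‖c (ρ k)‖ = ‖c (ρ j)‖ ∧ ρ j < ρ k)

/-- Every null sequence has a greedy ordering. (The coefficients of a vector with respect to a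
bounded Schauder basis form a null sequence.) -/
theorem exists_isGreedyOrdering (c : ℕ → ℂ) (hc : Tendsto c atTop (𝓝 0)) :
    ∃ ρ, IsGreedyOrdering c ρ := by
  have hfin : ∀ ε : ℝ, 0 < ε → {z | ε ≤ ‖c z‖}.Finite := by
    intro ε hε
    have h := (tendsto_zero_iff_norm_tendsto_zero.1 hc).eventually (gt_mem_nhds hε)
    obtain ⟨N, hN⟩ := eventually_atTop.1 h
    refine (Set.finite_lt_nat N).subset fun z hz => ?_
    by_contra hzN
    exact absurd (hN z (not_lt.1 hzN)) (not_lt.2 hz)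
  have hmax : ∀ s : Finset ℕ, ∃ y, y ∉ s ∧ ∀ z, z ∉ s → ‖c z‖ ≤ ‖c y‖ := by
    intro s
    by_cases h : ∃ z₀, z₀ ∉ s ∧ c z₀ ≠ 0
    · obtain ⟨z₀, hz₀, h0⟩ := h
      have hF : ({z | ‖c z₀‖ ≤ ‖c z‖} \ (s : Set ℕ)).Finite :=
        (hfin _ (norm_pos_iff.2 h0)).subset Set.sdiff_subset
      obtain ⟨y, hy, hymax⟩ := Set.exists_max_image _ (fun z => ‖c z‖) hF
        ⟨z₀, le_refl ‖c z₀‖, by simpa using hz₀⟩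
      refine ⟨y, by simpa using hy.2, fun z hz => ?_⟩
      by_cases hzz : ‖c z₀‖ ≤ ‖c z‖
      · exact hymax z ⟨hzz, by simpa using hz⟩
      · exact (not_le.1 hzz).le.trans hy.1
    · push Not at h
      obtain ⟨y, hy⟩ := Infinite.exists_notMem_finset s
      exact ⟨y, hy, fun z hz => by simp [h z hz]⟩
  have hpick : ∀ s : Finset ℕ, ∃ y, y ∉ s ∧
      ∀ z, z ∉ s → z ≠ y → ‖c z‖ < ‖c y‖ ∨ (‖c z‖ = ‖c y‖ ∧ y < z) := by
    classical
    intro s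
    obtain ⟨y₀, hy₀, hm⟩ := hmax s
    have hex : ∃ y, y ∉ s ∧ ‖c y‖ = ‖c y₀‖ := ⟨y₀, hy₀, rfl⟩
    obtain ⟨h1, h2⟩ := Nat.find_spec hex
    refine ⟨Nat.find hex, h1, fun z hz hne => ?_⟩
    rcases (hm z hz).lt_or_eq with hlt | heq
    · left; rwa [h2]
    · right
      exact ⟨heq.trans h2.symm, lt_of_le_of_ne (Nat.find_min' hex ⟨hz, heq⟩) (Ne.symm hne)⟩
  classical
  choose f hf1 hf2 using hpick
  let S : ℕ → Finset ℕ := fun n => Nat.rec ∅ (fun _ s => insert (f s) s) n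
  have hS : ∀ n, S (n + 1) = insert (f (S n)) (S n) := fun _ => rfl
  have hmono : Monotone S := monotone_nat_of_le_succ fun n => by
    rw [hS]; exact Finset.subset_insert _ _
  have hlt : ∀ j k, j < k → ‖c (f (S k))‖ < ‖c (f (S j))‖ ∨
      (‖c (f (S k))‖ = ‖c (f (S j))‖ ∧ f (S j) < f (S k)) := by
    intro j k hjk
    refine hf2 (S j) _ (fun h => hf1 (S k) (hmono hjk.le h)) fun h => hf1 (S k) ?_
    rw [h]
    exact hmono (Nat.succ_le_of_lt hjk) (by rw [hS]; exact Finset.mem_insert_self _ _)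
  refine ⟨fun n => f (S n), fun j hj => ?_, hlt⟩
  by_contra hcon
  have hnot : ∀ n, j ∉ S n := by
    intro n
    induction n with
    | zero => exact Finset.notMem_empty j
    | succ n ih =>
      rw [hS, Finset.mem_insert, not_or]
      exact ⟨fun h => hcon ⟨n, h.symm⟩, ih⟩
  have hinj : Function.Injective fun n => f (S n) := by
    intro a b hab
    have hab' : f (S a) = f (S b) := hab
    by_contra hne
    rcases lt_or_gt_of_ne hne with h | h
    · have := hlt a b h
      rw [hab'] at this
      simp at this
    · have := hlt b a h
      rw [hab'] at this
      simp at this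
  refine Set.infinite_range_of_injective hinj ((hfin ‖c j‖ (norm_pos_iff.2 hj)).subset ?_)
  rintro _ ⟨n, rfl⟩
  rcases hf2 (S n) j (hnot n) (fun h => hcon ⟨n, h.symm⟩) with h | h
  · exact h.le
  · exact h.1.le

/-- A sequence `b` in `X` is a quasi-greedy basis if it is a bounded Schauder basis of `X`
(`0 < inf ‖b k‖` and `sup ‖b k‖ < ∞`) such that, for every `x`, the greedy approximants
`∑_{j < m} b*_{ρ(j)}(x) b_{ρ(j)}`, with `ρ` the greedy ordering of the coefficients of `x`,
converge to `x` in norm. -/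
def IsQuasiGreedyBasis {X : Type*} [NormedAddCommGroup X] [NormedSpace ℂ X] (b : ℕ → X) : Prop :=
  ∃ B : SchauderBasis ℂ X, (∀ k, B.basis k = b k) ∧
    (∃ r R : ℝ, 0 < r ∧ ∀ k, r ≤ ‖b k‖ ∧ ‖b k‖ ≤ R) ∧
    ∀ (x : X) (ρ : ℕ → ℕ), IsGreedyOrdering (fun k => B.coord k x) ρ →
      Tendsto (fun m => ∑ j ∈ Finset.range m, B.coord (ρ j) x • b (ρ j)) atTop (𝓝 x)

/-! ### Weights and weighted spaces on `[-π, π)` -/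

/-- A nonnegative (Lebesgue measurable, possibly infinite) `2π`-periodic weight. -/
structure IsPeriodicWeight (w : ℝ → ℝ≥0∞) : Prop where
  aemeasurable : AEMeasurable w volume
  periodic : Function.Periodic w (2 * Real.pi)

/-- The Muckenhoupt class `A_p`. In `ℝ≥0∞` one has `0 * ∞ = 0`, and a negative power of `0`
is `∞`. -/
def IsMuckenhouptWeight (p : ℝ) (w : ℝ → ℝ≥0∞) : Prop :=
  IsPeriodicWeight w ∧ ∃ K : ℝ≥0, ∀ a b : ℝ, a < b →
    ((ENNReal.ofReal (b - a))⁻¹ * ∫⁻ t in Set.Ioo a b, w t) *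
      ((ENNReal.ofReal (b - a))⁻¹ * ∫⁻ t in Set.Ioo a b, w t ^ (-(1 / (p - 1)))) ^ (p - 1) ≤ K

/-- The measure `w(t) dt` on `[-π, π)`; the space `L^p(𝕋; w)` is `Lp ℂ p (weightMeasure w)`. -/
noncomputable def weightMeasure (w : ℝ → ℝ≥0∞) : Measure ℝ :=
  (volume.restrict (Set.Ico (-Real.pi) Real.pi)).withDensity w

/-! ### The trigonometric system in its natural ordering -/

/-- The enumeration `0, -1, 1, -2, 2, …` of `ℤ`. -/
def naturalOrder (k : ℕ) : ℤ :=
  if Even k then ((k / 2 : ℕ) : ℤ) else -(((k + 1) / 2 : ℕ) : ℤ)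

/-- The trigonometric system in its natural ordering, `t ↦ (2π)^{-1/2} e^{i n_k t}`. -/
noncomputable def trigSystem (k : ℕ) (t : ℝ) : ℂ :=
  (((Real.sqrt (2 * Real.pi))⁻¹ : ℝ) : ℂ) * Complex.exp (Complex.I * (naturalOrder k : ℂ) * (t : ℂ))

/-- The trigonometric system, in its natural ordering, consists of elements of `L^p(𝕋; w)` and is
a quasi-greedy basis of this space. -/
def TrigIsQuasiGreedyBasis (p : ℝ≥0∞) [Fact (1 ≤ p)] (w : ℝ → ℝ≥0∞) : Prop :=
  ∃ h : ∀ k, MemLp (trigSystem k) p (weightMeasure w),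
    IsQuasiGreedyBasis fun k => (h k).toLp (trigSystem k)

/-!
The theorem rests on comparing unimodular trigonometric polynomials of the same length.

For a quasi-greedy basis the norms of `∑_{j ∈ A} ε_j b_j`, `|ε_j| = 1`, are comparable to each other
uniformly in the finite set `A` and in the coefficients
(`IsQuasiGreedyBasis.exists_unimodular_bound`). Sub-sums are controlled by full sums, for otherwise a
gliding hump produces a vector with divergent greedy approximants
(`SchauderBasis.GreedyConverges.exists_tail_bound`); changes of coefficients then follow by convexity.

For the trigonometric system, a translation of a polynomial only rotates its coefficients. Hence the
weighted norms of all translates of all unimodular polynomials of length `N` are comparable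
(`TrigIsQuasiGreedyBasis.exists_trigEnergy_le`). The average over translations separates the
polynomial from the weight (`lintegral_trigEnergy`), so the unweighted `L^p` norms of all unimodular
polynomials of length `N` are comparable too. The Dirichlet kernel has norm of order `N ^ (1 - 1 / p)`
and Golay–Rudin–Shapiro polynomials have norm of order `N ^ (1 / 2)`, which forces `p = 2`
(`eq_two_of_forall_lintegral_trigSum_le`). Using flat polynomials makes Khintchine's inequality
unnecessary.

For `p = 2`, the convolution of the weight with the Fejér kernel `|D_N|² / N` is thus bounded above
and below at every point. As `|D_N|² / N` is of size `N` on an interval of length of order `1 / N`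
around `0` and has small mass outside a fixed multiple of it, the averages of the weight over small
intervals are bounded above and then below, and differentiation gives the two bounds on the weight
(`ae_le_of_trigEnergy_le`, `exists_pos_ae_le_of_le_trigEnergy`). A weight with such bounds is in
`A_2`.
-/

/-! ### Unimodular sums of a quasi-greedy basis -/

theorem IsGreedyOrdering.injective {c : ℕ → ℂ} {ρ : ℕ → ℕ} (h : IsGreedyOrdering c ρ) :
    Function.Injective ρ := by
  have key : ∀ j k, j < k → ρ j ≠ ρ k := by
    intro j k hjk he
    rcases h.2 j k hjk with h | h
    · rw [he] at h; exact lt_irrefl _ h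
    · rw [he] at h; exact lt_irrefl _ h.2
  intro j k hjk
  by_contra hne
  rcases lt_or_gt_of_ne hne with h | h
  · exact key _ _ h hjk
  · exact key _ _ h hjk.symm

/-- A finite set on which the coefficients strictly dominate all the others is an initial segment
of every greedy ordering. -/
theorem IsGreedyOrdering.image_range_card {c : ℕ → ℂ} {ρ : ℕ → ℕ} (h : IsGreedyOrdering c ρ)
    {T : Finset ℕ} (hT : ∀ j ∈ T, ∀ i ∉ T, ‖c i‖ < ‖c j‖) :
    (Finset.range T.card).image ρ = T := by
  have hsub : T ⊆ (Finset.range T.card).image ρ := by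
    intro j hj
    obtain ⟨i, hi⟩ := Infinite.exists_notMem_finset T
    have hcj : c j ≠ 0 := norm_pos_iff.1 ((norm_nonneg _).trans_lt (hT j hj i hi))
    obtain ⟨k, rfl⟩ := h.1 hcj
    have hk : (Finset.range (k + 1)).image ρ ⊆ T := by
      intro i hi
      obtain ⟨l, hl, rfl⟩ := Finset.mem_image.1 hi
      by_contra hnot
      have h1 := hT _ hj _ hnot
      rcases (Nat.lt_succ_iff.1 (Finset.mem_range.1 hl)).lt_or_eq with hlk | rfl
      · rcases h.2 l k hlk with h2 | h2
        · exact lt_asymm h1 h2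
        · exact h1.ne h2.1.symm
      · exact lt_irrefl _ h1
    have hcard := Finset.card_le_card hk
    rw [Finset.card_image_of_injective _ h.injective, Finset.card_range] at hcard
    exact Finset.mem_image_of_mem _ (Finset.mem_range.2 hcard)
  refine (Finset.eq_of_subset_of_card_le hsub ?_).symm
  rw [Finset.card_image_of_injective _ h.injective, Finset.card_range]

section Abstract

variable {X : Type*} [NormedAddCommGroup X] [NormedSpace ℂ X]

theorem SchauderBasis.coord_sum (B : SchauderBasis ℂ X) (A : Finset ℕ) (ε : ℕ → ℂ) (j : ℕ) :
    B.coord j (∑ i ∈ A, ε i • B.basis i) = if j ∈ A then ε j else 0 := by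
  simp [map_sum, B.ortho, Pi.single_apply]

/-- The coordinate functionals of a Schauder basis that is bounded away from zero are uniformly
bounded. -/
theorem SchauderBasis.exists_norm_coord_le [CompleteSpace X] (B : SchauderBasis ℂ X) {r : ℝ}
    (hr : 0 < r) (hB : ∀ k, r ≤ ‖B.basis k‖) :
    ∃ β : ℝ, 0 < β ∧ ∀ k x, ‖B.coord k x‖ ≤ β * ‖x‖ := by
  obtain ⟨C, hC⟩ := B.exists_norm_proj_le
  have hC0 : 0 ≤ C := (norm_nonneg _).trans (hC 0)
  refine ⟨2 * (C + 1) / r, by positivity, fun k x => ?_⟩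
  have h1 : B.coord k x • B.basis k = SchauderBasis.proj B (k + 1) x - SchauderBasis.proj B k x := by
    simp [Finset.sum_range_succ]
  have h2 : ‖B.coord k x‖ * r ≤ 2 * (C + 1) * ‖x‖ := by
    calc ‖B.coord k x‖ * r ≤ ‖B.coord k x‖ * ‖B.basis k‖ := by gcongr; exact hB k
      _ = ‖SchauderBasis.proj B (k + 1) x - SchauderBasis.proj B k x‖ := by rw [← norm_smul, h1]
      _ ≤ C * ‖x‖ + C * ‖x‖ := (norm_sub_le _ _).trans (add_le_add
          ((ContinuousLinearMap.le_opNorm _ _).trans (by gcongr; exact hC _))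
          ((ContinuousLinearMap.le_opNorm _ _).trans (by gcongr; exact hC _)))
      _ ≤ 2 * (C + 1) * ‖x‖ := by nlinarith [norm_nonneg x]
  rw [div_mul_eq_mul_div, le_div_iff₀ hr]
  exact h2

/-- The greedy convergence condition: every sum over the first `m` terms of a greedy ordering
converges to the vector. -/
def SchauderBasis.GreedyConverges (B : SchauderBasis ℂ X) : Prop :=
  ∀ (x : X) (ρ : ℕ → ℕ), IsGreedyOrdering (fun k => B.coord k x) ρ →
    Tendsto (fun m => ∑ j ∈ Finset.range m, B.coord (ρ j) x • B.basis (ρ j)) atTop (𝓝 x)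

/-- Greedy convergence, phrased without orderings: the partial expansions of `x` over finite sets
on which the coefficients strictly dominate all the others converge to `x`. -/
theorem SchauderBasis.GreedyConverges.tendsto_sum [CompleteSpace X] {B : SchauderBasis ℂ X}
    (hG : SchauderBasis.GreedyConverges B) {r : ℝ} (hr : 0 < r) (hB : ∀ k, r ≤ ‖B.basis k‖) (x : X)
    (T : ℕ → Finset ℕ)
    (hT : ∀ n, ∀ j ∈ T n, ∀ i ∉ T n, ‖B.coord i x‖ < ‖B.coord j x‖)
    (hcard : Tendsto (fun n => (T n).card) atTop atTop) :
    Tendsto (fun n => ∑ j ∈ T n, B.coord j x • B.basis j) atTop (𝓝 x) := by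
  have hnull : Tendsto (fun k => B.coord k x) atTop (𝓝 0) := by
    have h1 := SchauderBasis.tendsto_proj B x
    have h2 := ((tendsto_add_atTop_iff_nat 1).2 h1).sub h1
    rw [sub_self] at h2
    have h3 := (tendsto_zero_iff_norm_tendsto_zero.1 h2).div_const r
    rw [zero_div] at h3
    refine squeeze_zero_norm (fun k => ?_) h3
    have h4 : SchauderBasis.proj B (k + 1) x - SchauderBasis.proj B k x
        = B.coord k x • B.basis k := by
      simp [Finset.sum_range_succ]
    rw [h4, norm_smul, le_div_iff₀ hr]
    gcongr
    exact hB k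
  obtain ⟨ρ, hρ⟩ := exists_isGreedyOrdering _ hnull
  refine ((hG x ρ hρ).comp hcard).congr fun n => ?_
  have h := hρ.image_range_card (hT n)
  conv_rhs => rw [← h]
  rw [Finset.sum_image (hρ.injective.injOn)]
  rfl

/-- The gliding hump. If greedy approximation converged for every vector, but sub-sums of
unimodular sums were not controlled by the full sums on any tail, one could stack a sequence of
bad pairs `S k ⊆ A k` into one vector whose greedy approximants do not form a Cauchy sequence. -/
theorem SchauderBasis.GreedyConverges.exists_tail_bound [CompleteSpace X] {B : SchauderBasis ℂ X}
    (hG : SchauderBasis.GreedyConverges B) {r : ℝ} (hr : 0 < r) (hB : ∀ k, r ≤ ‖B.basis k‖) :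
    ∃ (M : ℕ) (K : ℝ), 0 ≤ K ∧ ∀ (A S : Finset ℕ) (ε : ℕ → ℂ), S ⊆ A → (∀ j ∈ A, M ≤ j) →
      (∀ j, ‖ε j‖ = 1) → ‖∑ j ∈ S, ε j • B.basis j‖ ≤ K * ‖∑ j ∈ A, ε j • B.basis j‖ := by
  by_contra! hcon
  obtain ⟨β, hβ, hcoord⟩ := SchauderBasis.exists_norm_coord_le B hr hB
  -- One step: beyond `M` there is a pair whose ratio exceeds `2 ^ n` and whose small set has a
  -- sum of norm at least `l`; the latter since full unimodular sums have norm at least `β⁻¹`.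
  have step : ∀ (n M : ℕ) (l : ℝ), ∃ D : Finset ℕ × Finset ℕ × (ℕ → ℂ), D.2.1 ⊆ D.1 ∧
      (∀ j ∈ D.1, M ≤ j) ∧ (∀ j, ‖D.2.2 j‖ = 1) ∧
      2 ^ n * ‖∑ j ∈ D.1, D.2.2 j • B.basis j‖ ≤ ‖∑ j ∈ D.2.1, D.2.2 j • B.basis j‖ ∧
      l ≤ ‖∑ j ∈ D.2.1, D.2.2 j • B.basis j‖ ∧ 0 < ‖∑ j ∈ D.2.1, D.2.2 j • B.basis j‖ := by
    intro n M l
    obtain ⟨A, S, ε, hSA, hA, hε, hlt⟩ := hcon M (2 ^ n + β * |l|) (by positivity)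
    have hpos : 0 < ‖∑ j ∈ S, ε j • B.basis j‖ := lt_of_le_of_lt (by positivity) hlt
    have hS : S.Nonempty := by
      by_contra h
      rw [Finset.not_nonempty_iff_eq_empty] at h
      simp [h] at hpos
    obtain ⟨j, hj⟩ := hS
    have h1 := hcoord j (∑ j ∈ A, ε j • B.basis j)
    rw [SchauderBasis.coord_sum, if_pos (hSA hj), hε] at h1
    have hl : |l| ≤ β * |l| * ‖∑ j ∈ A, ε j • B.basis j‖ := by nlinarith [abs_nonneg l]
    refine ⟨(A, S, ε), hSA, hA, hε, ?_, ?_, hpos⟩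
    · refine le_trans ?_ hlt.le
      gcongr
      exact le_add_of_nonneg_right (by positivity)
    · refine (le_abs_self l).trans (hl.trans (le_trans ?_ hlt.le))
      gcongr
      exact le_add_of_nonneg_left (by positivity)
  choose f hf1 hf2 hf3 hf4 hf5 hf6 using step
  -- Iterate: each new pair lies beyond the previous one, and the norms of the small sums at least
  -- quadruple, so that their inverses `1 / l n` decrease fast enough to order the blocks.
  let nrm : Finset ℕ × Finset ℕ × (ℕ → ℂ) → ℝ := fun D => ‖∑ j ∈ D.2.1, D.2.2 j • B.basis j‖
  let D : ℕ → Finset ℕ × Finset ℕ × (ℕ → ℂ) := fun n =>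
    Nat.rec (f 0 0 0) (fun n d => f (n + 1) (d.1.sup id + 1) (4 * nrm d)) n
  obtain ⟨A, hAdef⟩ : ∃ A : ℕ → Finset ℕ, ∀ n, A n = (D n).1 := ⟨_, fun _ => rfl⟩
  obtain ⟨S, hSdef⟩ : ∃ S : ℕ → Finset ℕ, ∀ n, S n = (D n).2.1 := ⟨_, fun _ => rfl⟩
  obtain ⟨ε, hεdef⟩ : ∃ ε : ℕ → ℕ → ℂ, ∀ n, ε n = (D n).2.2 := ⟨_, fun _ => rfl⟩
  obtain ⟨l, hldef⟩ : ∃ l : ℕ → ℝ, ∀ n, l n = ‖∑ j ∈ S n, ε n j • B.basis j‖ :=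
    ⟨_, fun _ => rfl⟩
  have hSA : ∀ n, S n ⊆ A n := by
    intro n; rw [hSdef, hAdef]; cases n <;> exact hf1 _ _ _
  have hε : ∀ n j, ‖ε n j‖ = 1 := by
    intro n; rw [hεdef]; cases n <;> exact hf3 _ _ _
  have hratio : ∀ n, 2 ^ n * ‖∑ j ∈ A n, ε n j • B.basis j‖ ≤ l n := by
    intro n; rw [hldef, hSdef, hεdef, hAdef]; cases n <;> exact hf4 _ _ _
  have hlpos : ∀ n, 0 < l n := by
    intro n; rw [hldef, hSdef, hεdef]; cases n <;> exact hf6 _ _ _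
  have hlsucc : ∀ n, 4 * l n ≤ l (n + 1) := by
    intro n; rw [hldef, hldef, hSdef, hεdef, hSdef, hεdef]; exact hf5 _ _ _
  have hAsucc : ∀ n, ∀ i ∈ A n, ∀ j ∈ A (n + 1), i < j := by
    intro n i hi j hj
    rw [hAdef] at hi hj
    exact Nat.lt_of_succ_le
      ((Nat.succ_le_succ (Finset.le_sup (f := id) hi)).trans (hf2 _ _ _ j hj))
  have hSne : ∀ n, (S n).Nonempty := by
    intro n
    by_contra h
    rw [Finset.not_nonempty_iff_eq_empty] at h
    have := hlpos n
    simp [hldef, h] at this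
  have hAlt : ∀ m n, m < n → ∀ i ∈ A m, ∀ j ∈ A n, i < j := by
    intro m n hmn
    induction n, hmn using Nat.le_induction with
    | base => exact hAsucc m
    | succ n _ ih =>
      intro i hi j hj
      obtain ⟨z, hz⟩ := hSne n
      exact (ih i hi z (hSA n hz)).trans (hAsucc n z (hSA n hz) j hj)
  have hAdisj : ∀ m n j, j ∈ A m → j ∈ A n → m = n := by
    intro m n j hm hn
    by_contra hne
    rcases lt_or_gt_of_ne hne with h | h
    · exact lt_irrefl _ (hAlt _ _ h j hm j hn)
    · exact lt_irrefl _ (hAlt _ _ h j hn j hm)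
  have hlmono : ∀ m n, m < n → 4 * l m ≤ l n := by
    intro m n hmn
    induction n, hmn using Nat.le_induction with
    | base => exact hlsucc m
    | succ n _ ih => linarith [hlsucc n, hlpos n]
  -- The coefficients: `1 / l n` on `A n`, enlarged on `S n` by the factor `1 + 2 ^ (-n)`, which puts
  -- `S n` before the rest of `A n` in the greedy ordering and costs only a summable amount.
  obtain ⟨a, ha⟩ : ∃ a : ℕ → ℕ → ℝ, ∀ n j,
      a n j = (l n)⁻¹ * (if j ∈ S n then 1 + (1 / 2) ^ n else 1) := ⟨_, fun _ _ => rfl⟩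
  have hhalf : ∀ n : ℕ, (0 : ℝ) < (1 / 2) ^ n ∧ ((1 : ℝ) / 2) ^ n ≤ 1 := fun n =>
    ⟨by positivity, pow_le_one₀ (by norm_num) (by norm_num)⟩
  have ha_lower : ∀ n j, (l n)⁻¹ ≤ a n j := by
    intro n j
    have := inv_pos.2 (hlpos n)
    rw [ha]
    split_ifs <;> nlinarith [hhalf n]
  have ha_upper : ∀ n j, a n j ≤ 2 * (l n)⁻¹ := by
    intro n j
    have := inv_pos.2 (hlpos n)
    rw [ha]
    split_ifs <;> nlinarith [hhalf n]
  have ha_pos : ∀ n j, 0 < a n j := fun n j => (inv_pos.2 (hlpos n)).trans_le (ha_lower n j)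
  have ha_lt : ∀ m n i j, m < n → a n j < a m i := by
    intro m n i j hmn
    refine lt_of_le_of_lt (ha_upper n j) (lt_of_lt_of_le ?_ (ha_lower m i))
    have h1 := hlmono m n hmn
    have h2 := hlpos m
    have h3 := hlpos n
    rw [← div_eq_mul_inv, div_lt_iff₀ h3, ← div_eq_inv_mul, lt_div_iff₀ h2]
    linarith
  let y : ℕ → X := fun n => ∑ j ∈ A n, ((a n j : ℂ) * ε n j) • B.basis j
  have hy : ∀ n, ‖y n‖ ≤ 2 * (1 / 2) ^ n := by
    intro n
    have hsplit : y n = (((l n)⁻¹ : ℝ) : ℂ) • ∑ j ∈ A n, ε n j • B.basis j +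
        (((l n)⁻¹ * (1 / 2) ^ n : ℝ) : ℂ) • ∑ j ∈ S n, ε n j • B.basis j := by
      rw [← Finset.inter_eq_right.2 (hSA n), ← Finset.sum_ite_mem, Finset.smul_sum,
        Finset.smul_sum, ← Finset.sum_add_distrib]
      refine Finset.sum_congr rfl fun j _ => ?_
      rw [ha]
      split_ifs
      · rw [smul_smul, smul_smul, ← add_smul]
        congr 1
        push_cast
        ring
      · rw [smul_zero, add_zero, smul_smul, mul_one]
    have hl := hlpos n
    have h1 : (l n)⁻¹ * ‖∑ j ∈ A n, ε n j • B.basis j‖ ≤ (1 / 2) ^ n := by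
      have := hratio n
      rw [one_div, inv_pow, ← div_eq_inv_mul, div_le_iff₀ hl, ← div_eq_inv_mul,
        le_div_iff₀ (by positivity), mul_comm]
      exact this
    have h2 : (l n)⁻¹ * (1 / 2) ^ n * ‖∑ j ∈ S n, ε n j • B.basis j‖ = (1 / 2) ^ n := by
      rw [← hldef]; field_simp
    rw [hsplit]
    refine (norm_add_le _ _).trans ?_
    rw [norm_smul, norm_smul, Complex.norm_real, Complex.norm_real, Real.norm_of_nonneg
      (by positivity), Real.norm_of_nonneg (by positivity), h2]
    linarith
  have hsum : Summable y :=
    Summable.of_norm_bounded ((summable_geometric_of_lt_one (by norm_num) (by norm_num)).mul_left 2)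
      hy
  obtain ⟨x, hx⟩ := hsum
  have hcoordx : ∀ j, HasSum (fun n => B.coord j (y n)) (B.coord j x) := fun j =>
    (B.coord j).hasSum hx
  have hin : ∀ n, ∀ j ∈ A n, B.coord j x = (a n j : ℂ) * ε n j := by
    intro n j hj
    refine (hcoordx j).unique ?_
    have h1 : (a n j : ℂ) * ε n j = B.coord j (y n) := by
      rw [SchauderBasis.coord_sum B (A n) (fun j => (a n j : ℂ) * ε n j), if_pos hj]
    rw [h1]
    refine hasSum_single n fun m hm => ?_
    rw [SchauderBasis.coord_sum B (A m) (fun j => (a m j : ℂ) * ε m j),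
      if_neg fun h => hm (hAdisj _ _ _ h hj)]
  have hout : ∀ j, (∀ n, j ∉ A n) → B.coord j x = 0 := by
    intro j hj
    refine (hcoordx j).unique ?_
    convert hasSum_zero with n
    rw [SchauderBasis.coord_sum B (A n) (fun j => (a n j : ℂ) * ε n j), if_neg (hj n)]
  have hnorm : ∀ n, ∀ j ∈ A n, ‖B.coord j x‖ = a n j := by
    intro n j hj
    rw [hin n j hj, norm_mul, hε, mul_one, Complex.norm_real, Real.norm_of_nonneg (ha_pos n j).le]
  -- Both `T n` and `T n ∪ S n` are initial segments of the greedy ordering of `x`, and the expansions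
  -- over them differ by a vector of norm at least `1`.
  let T : ℕ → Finset ℕ := fun n => (Finset.range n).biUnion A
  have hTmem : ∀ n j, j ∈ T n ↔ ∃ m < n, j ∈ A m := by
    intro n j; simp [T]
  have hcardT : ∀ n, n ≤ (T n).card := by
    intro n
    rw [Finset.card_biUnion]
    · calc n = ∑ _i ∈ Finset.range n, 1 := by simp
        _ ≤ _ := Finset.sum_le_sum fun i _ => Finset.card_pos.2 ((hSne i).mono (hSA i))
    · intro m _ n _ hmn
      rw [Function.onFun, Finset.disjoint_left]
      exact fun j hm hn => hmn (hAdisj _ _ _ hm hn)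
  have hT1 := hG.tendsto_sum hr hB x T ?_ (tendsto_atTop_mono hcardT tendsto_id)
  have hT2 := hG.tendsto_sum hr hB x (fun n => T n ∪ S n) ?_
    (tendsto_atTop_mono (fun n => (hcardT n).trans
      (Finset.card_le_card Finset.subset_union_left)) tendsto_id)
  · have hdiff := hT2.sub hT1
    rw [sub_self] at hdiff
    have hlarge : ∀ n, 1 ≤ ‖(∑ j ∈ T n ∪ S n, B.coord j x • B.basis j) -
        ∑ j ∈ T n, B.coord j x • B.basis j‖ := by
      intro n
      have hdisj : Disjoint (T n) (S n) := by
        rw [Finset.disjoint_left]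
        intro j hj hjS
        obtain ⟨m, hm, hjm⟩ := (hTmem n j).1 hj
        exact hm.ne (hAdisj _ _ _ hjm (hSA n hjS))
      have h1 : ∑ j ∈ S n, B.coord j x • B.basis j =
          (((l n)⁻¹ * (1 + (1 / 2) ^ n) : ℝ) : ℂ) • ∑ j ∈ S n, ε n j • B.basis j := by
        rw [Finset.smul_sum]
        refine Finset.sum_congr rfl fun j hj => ?_
        rw [hin n j (hSA n hj), ha, if_pos hj, smul_smul]
      have hl := hlpos n
      rw [Finset.sum_union hdisj, add_sub_cancel_left, h1, norm_smul, Complex.norm_real,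
        Real.norm_of_nonneg (by positivity), ← hldef]
      have : (l n)⁻¹ * (1 + (1 / 2) ^ n) * l n = 1 + (1 / 2) ^ n := by field_simp
      rw [this]
      linarith [(hhalf n).1]
    have := ge_of_tendsto' hdiff.norm hlarge
    norm_num at this
  · intro n j hj i hi
    rw [Finset.mem_union, not_or] at hi
    -- On `S n` the coefficients are strictly larger than on the rest of `A n`.
    have hj' : ∃ m ≤ n, j ∈ A m ∧ (m = n → j ∈ S n) := by
      rcases Finset.mem_union.1 hj with h | h
      · obtain ⟨m, hm, hjm⟩ := (hTmem n j).1 h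
        exact ⟨m, hm.le, hjm, fun h => absurd h hm.ne⟩
      · exact ⟨n, le_rfl, hSA n h, fun _ => h⟩
    obtain ⟨m, hm, hjm, hmS⟩ := hj'
    rw [hnorm m j hjm]
    by_cases hiA : ∃ k, i ∈ A k
    · obtain ⟨k, hk⟩ := hiA
      rw [hnorm k i hk]
      have hnk : n ≤ k := by
        by_contra h
        exact hi.1 ((hTmem n i).2 ⟨k, not_le.1 h, hk⟩)
      rcases (hm.trans hnk).lt_or_eq with h | h
      · exact ha_lt _ _ _ _ h
      · obtain rfl : m = n := le_antisymm hm (h ▸ hnk)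
        subst h
        rw [ha, ha, if_neg hi.2, if_pos (hmS rfl)]
        have := inv_pos.2 (hlpos m)
        nlinarith [hhalf m]
    · push Not at hiA
      rw [hout i hiA, norm_zero]
      exact ha_pos m j
  · intro n j hj i hi
    obtain ⟨m, hm, hjm⟩ := (hTmem n j).1 hj
    rw [hnorm m j hjm]
    by_cases hiA : ∃ k, i ∈ A k
    · obtain ⟨k, hk⟩ := hiA
      rw [hnorm k i hk]
      refine ha_lt _ _ _ _ (hm.trans_le ?_)
      by_contra h
      exact hi ((hTmem n i).2 ⟨k, not_le.1 h, hk⟩)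
    · push Not at hiA
      rw [hout i hiA, norm_zero]
      exact ha_pos m j

/-- Sub-sums of unimodular sums of a quasi-greedy basis are controlled by the full sums: on the
finitely many indices before the tail this follows from the continuity of the coordinates. -/
theorem SchauderBasis.GreedyConverges.exists_subset_bound [CompleteSpace X] {B : SchauderBasis ℂ X}
    (hG : SchauderBasis.GreedyConverges B) {r : ℝ} (hr : 0 < r) (hB : ∀ k, r ≤ ‖B.basis k‖) :
    ∃ K : ℝ, 0 ≤ K ∧ ∀ (A S : Finset ℕ) (ε : ℕ → ℂ), S ⊆ A → (∀ j, ‖ε j‖ = 1) →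
      ‖∑ j ∈ S, ε j • B.basis j‖ ≤ K * ‖∑ j ∈ A, ε j • B.basis j‖ := by
  obtain ⟨M, K, hK, hbound⟩ := hG.exists_tail_bound hr hB
  set Q : ℝ := ∑ j ∈ Finset.range M, ‖B.coord j‖ * ‖B.basis j‖ with hQ
  have hQ0 : 0 ≤ Q := Finset.sum_nonneg fun _ _ => by positivity
  refine ⟨Q + K * (1 + Q), by positivity, fun A S ε hSA hε => ?_⟩
  set x := ∑ j ∈ A, ε j • B.basis j with hx
  have hhead : ∀ U ⊆ A, ‖∑ j ∈ U with j < M, ε j • B.basis j‖ ≤ Q * ‖x‖ := by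
    intro U hU
    calc ‖∑ j ∈ U with j < M, ε j • B.basis j‖
        ≤ ∑ j ∈ U with j < M, ‖B.coord j‖ * ‖B.basis j‖ * ‖x‖ := by
          refine norm_sum_le_of_le _ fun j hj => ?_
          have h1 := (B.coord j).le_opNorm x
          rw [hx, SchauderBasis.coord_sum, if_pos (hU (Finset.mem_filter.1 hj).1), ← hx] at h1
          rw [norm_smul, mul_right_comm]
          gcongr
      _ ≤ ∑ j ∈ Finset.range M, ‖B.coord j‖ * ‖B.basis j‖ * ‖x‖ := by
          refine Finset.sum_le_sum_of_subset_of_nonneg (fun j hj => ?_) fun _ _ _ => by positivity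
          exact Finset.mem_range.2 (Finset.mem_filter.1 hj).2
      _ = Q * ‖x‖ := by rw [hQ, Finset.sum_mul]
  have htail : ‖∑ j ∈ A with ¬ j < M, ε j • B.basis j‖ ≤ (1 + Q) * ‖x‖ := by
    have h1 : ∑ j ∈ A with ¬ j < M, ε j • B.basis j =
        x - ∑ j ∈ A with j < M, ε j • B.basis j := by
      rw [hx, ← Finset.sum_filter_add_sum_filter_not A (fun j => j < M), add_sub_cancel_left]
    rw [h1]
    linarith [norm_sub_le x (∑ j ∈ A with j < M, ε j • B.basis j), hhead A subset_rfl]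
  have h2 := hbound (A.filter fun j => ¬ j < M) (S.filter fun j => ¬ j < M) ε
    (Finset.filter_subset_filter _ hSA) (fun j hj => not_lt.1 (Finset.mem_filter.1 hj).2) hε
  rw [← Finset.sum_filter_add_sum_filter_not S (fun j => j < M)]
  have h3 : K * ‖∑ j ∈ A with ¬ j < M, ε j • B.basis j‖ ≤ K * ((1 + Q) * ‖x‖) := by gcongr
  linarith [norm_add_le (∑ j ∈ S with j < M, ε j • B.basis j)
    (∑ j ∈ S with ¬ j < M, ε j • B.basis j), hhead S hSA]

/-- A bound on all sub-sums bounds the sums with coefficients in `[0, 1]`, which are convex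
combinations of sub-sums. -/
theorem norm_add_sum_smul_le {ι : Type*} (A : Finset ι) (y : ι → X) (a : ι → ℝ)
    (ha : ∀ i, 0 ≤ a i ∧ a i ≤ 1) (R : ℝ) (v : X) (h : ∀ S ⊆ A, ‖v + ∑ i ∈ S, y i‖ ≤ R) :
    ‖v + ∑ i ∈ A, (a i : ℂ) • y i‖ ≤ R := by
  classical
  induction A using Finset.induction_on generalizing v with
  | empty => simpa using h ∅ subset_rfl
  | insert i A hi ih =>
    have h1 := ih v fun S hS => h S (hS.trans (Finset.subset_insert _ _))
    have h2 := ih (v + y i) fun S hS => by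
      have := h (insert i S) (Finset.insert_subset_insert _ hS)
      rwa [Finset.sum_insert fun h => hi (hS h), ← add_assoc] at this
    rw [Finset.sum_insert hi]
    have h3 : v + ((a i : ℂ) • y i + ∑ j ∈ A, (a j : ℂ) • y j) =
        ((1 - a i : ℝ) : ℂ) • (v + ∑ j ∈ A, (a j : ℂ) • y j) +
          (a i : ℂ) • (v + y i + ∑ j ∈ A, (a j : ℂ) • y j) := by
      push_cast
      module
    rw [h3]
    refine (norm_add_le _ _).trans ?_
    rw [norm_smul, norm_smul, Complex.norm_real, Complex.norm_real,
      Real.norm_of_nonneg (ha i).1, Real.norm_of_nonneg (sub_nonneg.2 (ha i).2)]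
    nlinarith [ha i]

/-- A bound on all sub-sums bounds the sums with coefficients in the unit disc, by splitting these
into the positive and negative parts of their real and imaginary parts. -/
theorem norm_sum_smul_le_of_subset_sum_le {ι : Type*} (A : Finset ι) (y : ι → X) (z : ι → ℂ)
    (hz : ∀ i, ‖z i‖ ≤ 1) (R : ℝ) (h : ∀ S ⊆ A, ‖∑ i ∈ S, y i‖ ≤ R) :
    ‖∑ i ∈ A, z i • y i‖ ≤ 4 * R := by
  have key : ∀ a : ι → ℝ, (∀ i, |a i| ≤ 1) → ‖∑ i ∈ A, ((max (a i) 0 : ℝ) : ℂ) • y i‖ ≤ R := by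
    intro a ha
    have := norm_add_sum_smul_le A y (fun i => max (a i) 0)
      (fun i => ⟨le_max_right _ _, max_le ((le_abs_self _).trans (ha i)) zero_le_one⟩) R 0
      (by simpa using h)
    simpa using this
  have hre : ∀ i, |(z i).re| ≤ 1 := fun i => (Complex.abs_re_le_norm _).trans (hz i)
  have him : ∀ i, |(z i).im| ≤ 1 := fun i => (Complex.abs_im_le_norm _).trans (hz i)
  have hsplit : ∑ i ∈ A, z i • y i =
      (∑ i ∈ A, ((max (z i).re 0 : ℝ) : ℂ) • y i - ∑ i ∈ A, ((max (-(z i).re) 0 : ℝ) : ℂ) • y i) +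
      Complex.I • (∑ i ∈ A, ((max (z i).im 0 : ℝ) : ℂ) • y i -
        ∑ i ∈ A, ((max (-(z i).im) 0 : ℝ) : ℂ) • y i) := by
    have hp : ∀ t : ℝ, max t 0 - max (-t) 0 = t := fun t => by
      rcases le_total t 0 with h | h <;> simp [h]
    rw [← Finset.sum_sub_distrib, ← Finset.sum_sub_distrib, Finset.smul_sum,
      ← Finset.sum_add_distrib]
    refine Finset.sum_congr rfl fun i _ => ?_
    rw [← sub_smul, ← sub_smul, smul_smul, ← add_smul, ← Complex.ofReal_sub, ← Complex.ofReal_sub,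
      hp, hp, mul_comm, Complex.re_add_im]
  have h1 := key (fun i => (z i).re) hre
  have h2 := key (fun i => -(z i).re) (by simpa using hre)
  have h3 := key (fun i => (z i).im) him
  have h4 := key (fun i => -(z i).im) (by simpa using him)
  rw [hsplit]
  refine (norm_add_le _ _).trans ?_
  rw [norm_smul, Complex.norm_I, one_mul]
  refine (add_le_add (norm_sub_le _ _) (norm_sub_le _ _)).trans ?_
  linarith

/-- All unimodular sums of a quasi-greedy basis over a given finite set have comparable norms. -/
theorem IsQuasiGreedyBasis.exists_unimodular_bound [CompleteSpace X] {b : ℕ → X}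
    (hb : IsQuasiGreedyBasis b) :
    ∃ K : ℝ, 0 ≤ K ∧ ∀ (A : Finset ℕ) (ε η : ℕ → ℂ), (∀ j, ‖ε j‖ = 1) → (∀ j, ‖η j‖ = 1) →
      ‖∑ j ∈ A, ε j • b j‖ ≤ K * ‖∑ j ∈ A, η j • b j‖ := by
  obtain ⟨B, hBb, ⟨r, R, hr, hrR⟩, hG⟩ := hb
  obtain rfl : B.basis = b := funext hBb
  obtain ⟨K, hK, hsub⟩ := SchauderBasis.GreedyConverges.exists_subset_bound hG hr
    fun k => (hrR k).1
  refine ⟨4 * K, by positivity, fun A ε η hε hη => ?_⟩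
  have h := norm_sum_smul_le_of_subset_sum_le A (fun j => η j • B.basis j)
    (fun j => ε j / η j) (fun j => by simp [hε, hη]) _ fun S hS => hsub A S η hS hη
  have he : ∀ j, (ε j / η j) • η j • B.basis j = ε j • B.basis j := fun j => by
    rw [smul_smul, div_mul_cancel₀]
    exact norm_pos_iff.1 (by simp [hη])
  simp only [he] at h
  rw [mul_assoc]
  exact h

end Abstract

/-! ### Trigonometric polynomials with unimodular coefficients -/

/-- The analytic trigonometric polynomial `∑_{n < N} ε n e^{int}`. -/
noncomputable def trigSum (ε : ℕ → ℂ) (N : ℕ) (t : ℝ) : ℂ :=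
  ∑ n ∈ Finset.range N, ε n * Complex.exp (Complex.I * n * t)

theorem continuous_trigSum (ε : ℕ → ℂ) (N : ℕ) : Continuous (trigSum ε N) := by
  unfold trigSum
  fun_prop

theorem norm_exp_I_mul_natCast_mul (n : ℕ) (t : ℝ) : ‖Complex.exp (Complex.I * n * t)‖ = 1 := by
  rw [show Complex.I * n * t = ((n * t : ℝ) : ℂ) * Complex.I by push_cast; ring]
  exact Complex.norm_exp_ofReal_mul_I _

theorem trigSum_periodic (ε : ℕ → ℂ) (N : ℕ) : Function.Periodic (trigSum ε N) (2 * Real.pi) := by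
  intro t
  refine Finset.sum_congr rfl fun n _ => ?_
  rw [show Complex.I * n * ((t + 2 * Real.pi : ℝ) : ℂ) =
    Complex.I * n * t + n * (2 * Real.pi * Complex.I) by push_cast; ring, Complex.exp_add,
    Complex.exp_nat_mul_two_pi_mul_I, mul_one]

/-- Translating a trigonometric polynomial only rotates its coefficients. -/
theorem trigSum_sub (ε : ℕ → ℂ) (N : ℕ) (t θ : ℝ) :
    trigSum ε N (t - θ) = trigSum (fun n => ε n * Complex.exp (Complex.I * n * (-θ : ℝ))) N t := by
  refine Finset.sum_congr rfl fun n _ => ?_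
  dsimp only
  rw [mul_assoc (ε n), ← Complex.exp_add]
  congr 2
  push_cast
  ring

theorem norm_trigSum_le {ε : ℕ → ℂ} (hε : ∀ n, ‖ε n‖ = 1) (N : ℕ) (t : ℝ) :
    ‖trigSum ε N t‖ ≤ N := by
  refine (norm_sum_le _ _).trans ?_
  simp [hε, norm_exp_I_mul_natCast_mul]

theorem half_le_norm_trigSum_one {N : ℕ} {t : ℝ} (ht : |t| * N ≤ 1) :
    (N : ℝ) / 2 ≤ ‖trigSum 1 N t‖ := by
  refine le_trans ?_ (Complex.re_le_norm _)
  have h : ∀ n ∈ Finset.range N, (1 : ℝ) / 2 ≤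
      ((1 : ℕ → ℂ) n * Complex.exp (Complex.I * n * t)).re := by
    intro n hn
    rw [show Complex.I * n * t = ((n * t : ℝ) : ℂ) * Complex.I by push_cast; ring,
      Pi.one_apply, one_mul, Complex.exp_ofReal_mul_I_re]
    have h1 : |n * t| ≤ 1 := by
      rw [abs_mul, Nat.abs_cast, mul_comm]
      refine le_trans ?_ ht
      gcongr
      exact (Finset.mem_range.1 hn).le
    have h2 := Real.one_sub_sq_div_two_le_cos (x := n * t)
    have h3 : (n * t) ^ 2 ≤ 1 := (sq_le_one_iff_abs_le_one _).2 h1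
    linarith
  calc (N : ℝ) / 2 = ∑ _n ∈ Finset.range N, (1 : ℝ) / 2 := by simp [div_eq_mul_inv]
    _ ≤ _ := Finset.sum_le_sum h
    _ = _ := by rw [trigSum, Complex.re_sum]

/-- The decay of the Dirichlet kernel. -/
theorem norm_trigSum_one_mul_abs_le (N : ℕ) {t : ℝ} (ht : |t| ≤ Real.pi) :
    ‖trigSum 1 N t‖ * |t| ≤ Real.pi := by
  have hgeom : trigSum 1 N t * (Complex.exp (Complex.I * t) - 1) =
      Complex.exp (Complex.I * t) ^ N - 1 := by
    rw [← geom_sum_mul, trigSum]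
    congr 1
    refine Finset.sum_congr rfl fun n _ => ?_
    rw [Pi.one_apply, one_mul, ← Complex.exp_nat_mul]
    congr 1
    ring
  have h1 : ‖Complex.exp (Complex.I * t)‖ = 1 := by
    rw [mul_comm]; exact Complex.norm_exp_ofReal_mul_I t
  have h2 : ‖trigSum 1 N t‖ * ‖Complex.exp (Complex.I * t) - 1‖ ≤ 2 := by
    rw [← norm_mul, hgeom]
    refine (norm_sub_le _ _).trans ?_
    rw [norm_pow, h1, one_pow, norm_one]
    norm_num
  have h3 : 2 / Real.pi * |t| ≤ ‖Complex.exp (Complex.I * t) - 1‖ := by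
    rw [Complex.norm_exp_I_mul_ofReal_sub_one, norm_mul, Real.norm_ofNat, Real.norm_eq_abs]
    have := Real.mul_abs_le_abs_sin (x := t / 2) (by rw [abs_div, abs_two]; linarith)
    rw [abs_div, abs_two] at this
    linarith
  have h4 : ‖trigSum 1 N t‖ * (2 / Real.pi * |t|) ≤ 2 := le_trans (by gcongr) h2
  have hpi := Real.pi_pos
  have h5 : ‖trigSum 1 N t‖ * (2 / Real.pi * |t|) = 2 / Real.pi * (‖trigSum 1 N t‖ * |t|) := by ring
  rw [h5, div_mul_eq_mul_div, div_le_iff₀ hpi] at h4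
  linarith

/-- The Golay–Rudin–Shapiro pairs: two unimodular polynomials of length `2 ^ m` whose square
moduli add up to the constant `2 ^ (m + 1)`. In particular both are flat. -/
theorem exists_rudinShapiro_pair (m : ℕ) :
    ∃ a b : ℕ → ℂ, (∀ n, ‖a n‖ = 1) ∧ (∀ n, ‖b n‖ = 1) ∧
      ∀ t, ‖trigSum a (2 ^ m) t‖ ^ 2 + ‖trigSum b (2 ^ m) t‖ ^ 2 = 2 ^ (m + 1) := by
  induction m with
  | zero =>
    refine ⟨1, 1, by simp, by simp, fun t => ?_⟩
    simp [trigSum]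
    norm_num
  | succ m ih =>
    obtain ⟨a, b, ha, hb, hab⟩ := ih
    have hglue : ∀ (c : ℂ) (t : ℝ),
        trigSum (fun n => if n < 2 ^ m then a n else c * b (n - 2 ^ m)) (2 ^ (m + 1)) t =
          trigSum a (2 ^ m) t +
            c * (Complex.exp (Complex.I * (2 ^ m : ℕ) * t) * trigSum b (2 ^ m) t) := by
      intro c t
      rw [trigSum, pow_succ, mul_two, Finset.sum_range_add]
      congr 1
      · refine Finset.sum_congr rfl fun n hn => ?_
        rw [if_pos (Finset.mem_range.1 hn)]
      · rw [trigSum, Finset.mul_sum, Finset.mul_sum]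
        refine Finset.sum_congr rfl fun n _ => ?_
        rw [if_neg (by omega), Nat.add_sub_cancel_left, Nat.cast_add, mul_add, add_mul,
          Complex.exp_add]
        ring
    refine ⟨fun n => if n < 2 ^ m then a n else 1 * b (n - 2 ^ m),
      fun n => if n < 2 ^ m then a n else (-1) * b (n - 2 ^ m), fun n => ?_, fun n => ?_,
      fun t => ?_⟩
    · dsimp only; split_ifs <;> simp [ha, hb]
    · dsimp only; split_ifs <;> simp [ha, hb]
    · rw [hglue, hglue, one_mul, neg_one_mul, ← sub_eq_add_neg]
      have h := parallelogram_law_with_norm ℝ (trigSum a (2 ^ m) t)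
        (Complex.exp (Complex.I * (2 ^ m : ℕ) * t) * trigSum b (2 ^ m) t)
      rw [norm_mul, norm_exp_I_mul_natCast_mul, one_mul] at h
      rw [pow_succ _ (m + 1), ← hab t]
      linarith

/-! ### Weighted energies and their translates -/

theorem setLIntegral_Ico_eq_Ioc {a b : ℝ} (f : ℝ → ℝ≥0∞) :
    ∫⁻ s in Set.Ico a b, f s = ∫⁻ s in Set.Ioc a b, f s := by
  rw [Measure.restrict_congr_set Ico_ae_eq_Ioc]

theorem Function.Periodic.setLIntegral_comp_add {f : ℝ → ℝ≥0∞}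
    (hf : Function.Periodic f (2 * Real.pi)) (θ : ℝ) :
    ∫⁻ s in Set.Ico (-Real.pi) Real.pi, f (s + θ) = ∫⁻ s in Set.Ico (-Real.pi) Real.pi, f s := by
  have h1 : ∫⁻ s in Set.Ico (-Real.pi) Real.pi, f (s + θ) =
      ∫⁻ s in Set.Ioc (-Real.pi + θ) (-Real.pi + θ + 2 * Real.pi), f s := by
    have h := (measurePreserving_add_right volume θ).setLIntegral_comp_emb
      (measurableEmbedding_addRight θ) f (Set.Ico (-Real.pi) Real.pi)
    rw [h, Set.image_add_const_Ico, setLIntegral_Ico_eq_Ioc]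
    congr 3
    ring
  have h2 : ∫⁻ s in Set.Ico (-Real.pi) Real.pi, f s =
      ∫⁻ s in Set.Ioc (-Real.pi) (-Real.pi + 2 * Real.pi), f s := by
    rw [setLIntegral_Ico_eq_Ioc]
    congr 3
    ring
  rw [h1, h2]
  refine (isAddFundamentalDomain_Ioc Real.two_pi_pos _).setLIntegral_eq
    (isAddFundamentalDomain_Ioc Real.two_pi_pos _) f ?_
  rintro ⟨g, n, rfl⟩ x
  have := hf.zsmul n x
  rw [add_comm] at this
  exact this

/-- The `q`-th power of the norm, in the weight `w`, of the translate by `θ` of the trigonometric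
polynomial with coefficients `ε`, written with the translation on the weight. -/
noncomputable def trigEnergy (q : ℝ) (w : ℝ → ℝ≥0∞) (ε : ℕ → ℂ) (N : ℕ) (θ : ℝ) : ℝ≥0∞ :=
  ∫⁻ s in Set.Ico (-Real.pi) Real.pi, ‖trigSum ε N s‖ₑ ^ q * w (s + θ)

theorem trigEnergy_eq {q : ℝ} {w : ℝ → ℝ≥0∞} (hw : IsPeriodicWeight w) (ε : ℕ → ℂ) (N : ℕ)
    (θ : ℝ) : trigEnergy q w ε N θ =
      ∫⁻ t in Set.Ico (-Real.pi) Real.pi, ‖trigSum ε N (t - θ)‖ₑ ^ q * w t := by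
  have hper : Function.Periodic (fun t => ‖trigSum ε N (t - θ)‖ₑ ^ q * w t) (2 * Real.pi) := by
    intro t
    simp only
    rw [hw.periodic t, show t + 2 * Real.pi - θ = t - θ + 2 * Real.pi by ring,
      trigSum_periodic ε N]
  rw [← hper.setLIntegral_comp_add θ]
  simp only [add_sub_cancel_right]
  rfl

/-- The average of the energy over all translations separates the polynomial from the weight. -/
theorem lintegral_trigEnergy {q : ℝ} {w : ℝ → ℝ≥0∞} (hw : IsPeriodicWeight w) (ε : ℕ → ℂ)
    (N : ℕ) : ∫⁻ θ in Set.Ico (-Real.pi) Real.pi, trigEnergy q w ε N θ =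
      (∫⁻ s in Set.Ico (-Real.pi) Real.pi, ‖trigSum ε N s‖ₑ ^ q) *
        ∫⁻ t in Set.Ico (-Real.pi) Real.pi, w t := by
  have hmeas : Measurable fun s => ‖trigSum ε N s‖ₑ ^ q :=
    (continuous_trigSum ε N).enorm.measurable.pow_const q
  have hmeas2 : AEMeasurable (Function.uncurry fun θ s : ℝ => ‖trigSum ε N s‖ₑ ^ q * w (s + θ))
      ((volume.restrict (Set.Ico (-Real.pi) Real.pi)).prod
        (volume.restrict (Set.Ico (-Real.pi) Real.pi))) := by
    rw [Measure.prod_restrict]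
    refine AEMeasurable.restrict (AEMeasurable.mul (hmeas.comp measurable_snd).aemeasurable ?_)
    exact hw.aemeasurable.comp_quasiMeasurePreserving
      (quasiMeasurePreserving_add_swap volume volume)
  unfold trigEnergy
  rw [lintegral_lintegral_swap hmeas2, ← lintegral_mul_const _ hmeas]
  refine lintegral_congr fun s => ?_
  rw [← hw.periodic.setLIntegral_comp_add s, ← lintegral_const_mul'']
  · simp only [add_comm s]
  · exact (hw.aemeasurable.comp_quasiMeasurePreserving
      (measurePreserving_add_right volume s).quasiMeasurePreserving).restrict

theorem naturalOrder_two_mul (n : ℕ) : naturalOrder (2 * n) = n := by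
  simp [naturalOrder]

/-- The norm of a combination of the basis elements of frequencies `0, …, N - 1`, which have the
indices `0, 2, …, 2 (N - 1)`. -/
theorem enorm_sum_trigSystem {p : ℝ≥0∞} [Fact (1 ≤ p)] (hp' : p ≠ ∞) {w : ℝ → ℝ≥0∞}
    (hw : IsPeriodicWeight w) (h : ∀ k, MemLp (trigSystem k) p (weightMeasure w)) (ε : ℕ → ℂ)
    (N : ℕ) :
    ‖∑ n ∈ Finset.range N, ε n • (h (2 * n)).toLp (trigSystem (2 * n))‖ₑ ^ p.toReal =
      ‖(Real.sqrt (2 * Real.pi))⁻¹‖ₑ ^ p.toReal * trigEnergy p.toReal w ε N 0 := by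
  have hp0 : p ≠ 0 := (zero_lt_one.trans_le Fact.out).ne'
  have hq : 0 < p.toReal := ENNReal.toReal_pos hp0 hp'
  have hae : (∑ n ∈ Finset.range N, ε n • (h (2 * n)).toLp (trigSystem (2 * n)) :
      Lp ℂ p (weightMeasure w)) =ᵐ[weightMeasure w]
      fun t => (((Real.sqrt (2 * Real.pi))⁻¹ : ℝ) : ℂ) * trigSum ε N t := by
    have h1 : ∀ᵐ t ∂(weightMeasure w), ∀ n,
        (ε n • (h (2 * n)).toLp (trigSystem (2 * n)) : Lp ℂ p (weightMeasure w)) t =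
          ε n * trigSystem (2 * n) t := by
      rw [ae_all_iff]
      intro n
      filter_upwards [Lp.coeFn_smul (ε n) ((h (2 * n)).toLp (trigSystem (2 * n))),
        (h (2 * n)).coeFn_toLp] with t h2 h3
      rw [h2, Pi.smul_apply, h3, smul_eq_mul]
    filter_upwards [Lp.coeFn_fun_finsetSum (Finset.range N)
      (fun n => ε n • (h (2 * n)).toLp (trigSystem (2 * n))), h1] with t h2 h3
    rw [h2, trigSum, Finset.mul_sum]
    refine Finset.sum_congr rfl fun n _ => ?_
    rw [h3, trigSystem, naturalOrder_two_mul]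
    push_cast
    ring
  rw [Lp.enorm_def, eLpNorm_congr_ae hae, eLpNorm_eq_lintegral_rpow_enorm_toReal hp0 hp',
    ← ENNReal.rpow_mul, one_div, inv_mul_cancel₀ hq.ne', ENNReal.rpow_one, weightMeasure,
    lintegral_withDensity_eq_lintegral_mul₀ hw.aemeasurable.restrict, trigEnergy,
    ← lintegral_const_mul']
  · refine lintegral_congr fun t => ?_
    rw [Pi.mul_apply, enorm_mul, ENNReal.mul_rpow_of_nonneg _ _ hq.le, add_zero, mul_comm (w t),
      mul_assoc]
    congr 2
    rw [← ofReal_norm, ← ofReal_norm, Complex.norm_real]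
  · exact ENNReal.rpow_ne_top_of_nonneg hq.le enorm_ne_top
  · exact ((continuous_const.mul (continuous_trigSum ε N)).enorm.measurable.pow_const _).aemeasurable

/-- If the trigonometric system is a quasi-greedy basis, then all unimodular polynomials of the same
length, and all their translates, have comparable energies. -/
theorem TrigIsQuasiGreedyBasis.exists_trigEnergy_le {p : ℝ≥0∞} [Fact (1 ≤ p)] (hp' : p ≠ ∞)
    {w : ℝ → ℝ≥0∞} (hw : IsPeriodicWeight w) (hT : TrigIsQuasiGreedyBasis p w) :
    ∃ K : ℝ≥0, ∀ (N : ℕ) (ε η : ℕ → ℂ) (θ τ : ℝ), (∀ n, ‖ε n‖ = 1) → (∀ n, ‖η n‖ = 1) →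
      trigEnergy p.toReal w ε N θ ≤ K * trigEnergy p.toReal w η N τ := by
  obtain ⟨h, hb⟩ := hT
  obtain ⟨K, hK, hbound⟩ := hb.exists_unimodular_bound
  have hp0 : p ≠ 0 := (zero_lt_one.trans_le Fact.out).ne'
  have hq : 0 < p.toReal := ENNReal.toReal_pos hp0 hp'
  have key : ∀ (N : ℕ) (ε η : ℕ → ℂ), (∀ n, ‖ε n‖ = 1) → (∀ n, ‖η n‖ = 1) →
      trigEnergy p.toReal w ε N 0 ≤ (ENNReal.ofReal K) ^ p.toReal *
        trigEnergy p.toReal w η N 0 := by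
    intro N ε η hε hη
    have h1 := hbound ((Finset.range N).image (2 * ·)) (fun k => ε (k / 2)) (fun k => η (k / 2))
      (fun _ => hε _) (fun _ => hη _)
    rw [Finset.sum_image (fun a _ b _ hab => by simpa using hab),
      Finset.sum_image (fun a _ b _ hab => by simpa using hab)] at h1
    simp only [Nat.mul_div_cancel_left _ Nat.two_pos] at h1
    have h2 := ENNReal.ofReal_le_ofReal h1
    rw [ENNReal.ofReal_mul hK, ofReal_norm, ofReal_norm] at h2
    have h3 := ENNReal.rpow_le_rpow h2 hq.le
    rw [ENNReal.mul_rpow_of_nonneg _ _ hq.le, enorm_sum_trigSystem hp' hw h,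
      enorm_sum_trigSystem hp' hw h, mul_left_comm] at h3
    refine (ENNReal.mul_le_mul_iff_right ?_ ?_).1 h3
    · refine (ENNReal.rpow_pos ?_ enorm_ne_top).ne'
      rw [enorm_pos]
      exact inv_ne_zero (Real.sqrt_pos.2 Real.two_pi_pos).ne'
    · exact ENNReal.rpow_ne_top_of_nonneg hq.le enorm_ne_top
  have htrans : ∀ (N : ℕ) (ε : ℕ → ℂ) (θ : ℝ), trigEnergy p.toReal w ε N θ =
      trigEnergy p.toReal w (fun n => ε n * Complex.exp (Complex.I * n * (-θ : ℝ))) N 0 := by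
    intro N ε θ
    rw [trigEnergy_eq hw, trigEnergy_eq hw]
    simp only [trigSum_sub ε N, sub_zero]
  refine ⟨(ENNReal.ofReal K ^ p.toReal).toNNReal, fun N ε η θ τ hε hη => ?_⟩
  rw [ENNReal.coe_toNNReal (ENNReal.rpow_ne_top_of_nonneg hq.le ENNReal.ofReal_ne_top), htrans,
    htrans N η]
  refine key N _ _ (fun n => ?_) fun n => ?_
  · rw [norm_mul, hε, norm_exp_I_mul_natCast_mul, one_mul]
  · rw [norm_mul, hη, norm_exp_I_mul_natCast_mul, one_mul]

/-- If the trigonometric system is a quasi-greedy basis, then the weight has finite, positive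
mass: the latter because the basis elements are not zero. -/
theorem TrigIsQuasiGreedyBasis.lintegral_weight {p : ℝ≥0∞} [Fact (1 ≤ p)] (hp' : p ≠ ∞)
    {w : ℝ → ℝ≥0∞} (hw : IsPeriodicWeight w) (hT : TrigIsQuasiGreedyBasis p w) :
    ∫⁻ t in Set.Ico (-Real.pi) Real.pi, w t ≠ 0 ∧ ∫⁻ t in Set.Ico (-Real.pi) Real.pi, w t ≠ ∞ := by
  have hp0 : p ≠ 0 := (zero_lt_one.trans_le Fact.out).ne'
  have hq : 0 < p.toReal := ENNReal.toReal_pos hp0 hp'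
  obtain ⟨h, B, -, ⟨r, R, hr, hrR⟩, -⟩ := hT
  have h1 := enorm_sum_trigSystem hp' hw h 1 1
  have h2 : trigEnergy p.toReal w 1 1 0 = ∫⁻ t in Set.Ico (-Real.pi) Real.pi, w t := by
    simp [trigEnergy, trigSum]
  simp only [Finset.sum_range_one, Pi.one_apply, one_smul, h2, mul_zero] at h1
  have hpos : 0 < ‖(h 0).toLp (trigSystem 0)‖ := hr.trans_le (hrR 0).1
  constructor
  · intro h0
    rw [h0, mul_zero (_ ^ p.toReal), ENNReal.rpow_eq_zero_iff_of_pos hq, enorm_eq_zero] at h1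
    rw [h1, norm_zero] at hpos
    exact lt_irrefl _ hpos
  · intro htop
    rw [htop, ENNReal.mul_top] at h1
    · exact ENNReal.rpow_ne_top_of_nonneg hq.le enorm_ne_top h1
    · refine (ENNReal.rpow_pos ?_ enorm_ne_top).ne'
      rw [enorm_pos]
      exact inv_ne_zero (Real.sqrt_pos.2 Real.two_pi_pos).ne'

theorem volume_Ico_neg_pi_pi :
    volume (Set.Ico (-Real.pi) Real.pi) = ENNReal.ofReal (2 * Real.pi) := by
  rw [Real.volume_Ico]; congr 1; ring

/-- Averaging the first energy over the translations of the second polynomial. -/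
theorem trigEnergy_le_of_forall_le {q : ℝ} {w : ℝ → ℝ≥0∞} (hw : IsPeriodicWeight w) {K : ℝ≥0}
    {ε η : ℕ → ℂ} {N : ℕ} {θ : ℝ}
    (h : ∀ τ, trigEnergy q w ε N θ ≤ K * trigEnergy q w η N τ) :
    ENNReal.ofReal (2 * Real.pi) * trigEnergy q w ε N θ ≤
      K * ((∫⁻ s in Set.Ico (-Real.pi) Real.pi, ‖trigSum η N s‖ₑ ^ q) *
        ∫⁻ t in Set.Ico (-Real.pi) Real.pi, w t) := by
  rw [← lintegral_trigEnergy hw, ← lintegral_const_mul' _ _ ENNReal.coe_ne_top,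
    ← volume_Ico_neg_pi_pi, mul_comm, ← setLIntegral_const]
  exact lintegral_mono fun τ => h τ

/-- Averaging the first energy over its own translations. -/
theorem le_trigEnergy_of_forall_le {q : ℝ} {w : ℝ → ℝ≥0∞} (hw : IsPeriodicWeight w) {K : ℝ≥0}
    {ε η : ℕ → ℂ} {N : ℕ} {τ : ℝ}
    (h : ∀ θ, trigEnergy q w ε N θ ≤ K * trigEnergy q w η N τ) :
    (∫⁻ s in Set.Ico (-Real.pi) Real.pi, ‖trigSum ε N s‖ₑ ^ q) *
        ∫⁻ t in Set.Ico (-Real.pi) Real.pi, w t ≤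
      ENNReal.ofReal (2 * Real.pi) * (K * trigEnergy q w η N τ) := by
  rw [← lintegral_trigEnergy hw, ← volume_Ico_neg_pi_pi, mul_comm, ← setLIntegral_const]
  exact lintegral_mono fun θ => h θ

/-! ### Unweighted norms of Dirichlet kernels and of Rudin–Shapiro polynomials -/

theorem enorm_rpow_eq_ofReal {q : ℝ} (hq : 0 ≤ q) (z : ℂ) : ‖z‖ₑ ^ q = ENNReal.ofReal (‖z‖ ^ q) := by
  rw [← ofReal_norm, ENNReal.ofReal_rpow_of_nonneg (norm_nonneg _) hq]

theorem lintegral_trigSum_le_of_sq_le {q : ℝ} (hq : 0 ≤ q) {ε : ℕ → ℂ} {N : ℕ} {R : ℝ}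
    (h : ∀ t, ‖trigSum ε N t‖ ^ 2 ≤ R) :
    ∫⁻ s in Set.Ico (-Real.pi) Real.pi, ‖trigSum ε N s‖ₑ ^ q ≤
      ENNReal.ofReal (2 * Real.pi * R ^ (q / 2)) := by
  have hpt : ∀ s, ‖trigSum ε N s‖ₑ ^ q ≤ ENNReal.ofReal (R ^ (q / 2)) := by
    intro s
    rw [enorm_rpow_eq_ofReal hq]
    refine ENNReal.ofReal_le_ofReal ?_
    rw [show ‖trigSum ε N s‖ ^ q = (‖trigSum ε N s‖ ^ 2) ^ (q / 2) by
      rw [← Real.rpow_natCast_mul (norm_nonneg _)]; congr 1; push_cast; ring]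
    exact Real.rpow_le_rpow (by positivity) (h s) (by positivity)
  refine (lintegral_mono hpt).trans ?_
  rw [setLIntegral_const, volume_Ico_neg_pi_pi, mul_comm,
    ← ENNReal.ofReal_mul Real.two_pi_pos.le]

/-- At every point one of the two polynomials has square modulus at least `R`, which bounds the sum
of their `L^q` norms from below for every `q`. -/
theorem le_lintegral_trigSum_add {q : ℝ} (hq : 0 ≤ q) {a b : ℕ → ℂ} {N : ℕ} {R : ℝ} (hR : 0 ≤ R)
    (h : ∀ t, 2 * R ≤ ‖trigSum a N t‖ ^ 2 + ‖trigSum b N t‖ ^ 2) :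
    ENNReal.ofReal (2 * Real.pi * R ^ (q / 2)) ≤
      (∫⁻ s in Set.Ico (-Real.pi) Real.pi, ‖trigSum a N s‖ₑ ^ q) +
        ∫⁻ s in Set.Ico (-Real.pi) Real.pi, ‖trigSum b N s‖ₑ ^ q := by
  have hone : ∀ (c : ℕ → ℂ) (s : ℝ), R ≤ ‖trigSum c N s‖ ^ 2 →
      ENNReal.ofReal (R ^ (q / 2)) ≤ ‖trigSum c N s‖ₑ ^ q := by
    intro c s hs
    rw [enorm_rpow_eq_ofReal hq]
    refine ENNReal.ofReal_le_ofReal ?_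
    rw [show ‖trigSum c N s‖ ^ q = (‖trigSum c N s‖ ^ 2) ^ (q / 2) by
      rw [← Real.rpow_natCast_mul (norm_nonneg _)]; congr 1; push_cast; ring]
    exact Real.rpow_le_rpow hR hs (by positivity)
  have hpt : ∀ s, ENNReal.ofReal (R ^ (q / 2)) ≤ ‖trigSum a N s‖ₑ ^ q + ‖trigSum b N s‖ₑ ^ q := by
    intro s
    by_cases ha : R ≤ ‖trigSum a N s‖ ^ 2
    · exact (hone a s ha).trans le_self_add
    · exact (hone b s (by linarith [h s])).trans le_add_self
  rw [← lintegral_add_left ((continuous_trigSum a N).enorm.measurable.pow_const q),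
    ENNReal.ofReal_mul Real.two_pi_pos.le, ← volume_Ico_neg_pi_pi, mul_comm, ← setLIntegral_const]
  exact lintegral_mono hpt

theorem closedBall_zero_inv_subset {N : ℕ} (hN : 0 < N) :
    Metric.closedBall (0 : ℝ) (1 / N) ⊆ Set.Ico (-Real.pi) Real.pi := by
  have h1 : (1 : ℝ) / N ≤ 1 := by
    rw [div_le_one (by positivity)]
    exact_mod_cast hN
  rw [Real.closedBall_eq_Icc]
  intro s hs
  have := Real.pi_gt_three
  exact ⟨by linarith [hs.1], by linarith [hs.2]⟩

/-- The Dirichlet kernel of length `N` is at least `N / 2` on the interval of radius `1 / N`. -/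
theorem ofReal_le_enorm_trigSum_one {q : ℝ} (hq : 0 ≤ q) {N : ℕ} (hN : 0 < N) {s : ℝ}
    (hs : s ∈ Metric.closedBall (0 : ℝ) (1 / N)) :
    ENNReal.ofReal ((N / 2) ^ q) ≤ ‖trigSum 1 N s‖ₑ ^ q := by
  rw [enorm_rpow_eq_ofReal hq]
  refine ENNReal.ofReal_le_ofReal (Real.rpow_le_rpow (by positivity) ?_ hq)
  refine half_le_norm_trigSum_one ?_
  rw [mem_closedBall_zero_iff, Real.norm_eq_abs, le_div_iff₀ (by positivity)] at hs
  exact hs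

theorem le_lintegral_trigSum_one {q : ℝ} (hq : 0 ≤ q) {N : ℕ} (hN : 0 < N) :
    ENNReal.ofReal ((N / 2) ^ q * (2 / N)) ≤
      ∫⁻ s in Set.Ico (-Real.pi) Real.pi, ‖trigSum 1 N s‖ₑ ^ q := by
  calc ENNReal.ofReal ((N / 2) ^ q * (2 / N))
      = ∫⁻ _s in Metric.closedBall (0 : ℝ) (1 / N), ENNReal.ofReal ((N / 2) ^ q) := by
        rw [setLIntegral_const, Real.volume_closedBall, ← ENNReal.ofReal_mul (by positivity)]
        congr 2
        ring
    _ ≤ ∫⁻ s in Metric.closedBall (0 : ℝ) (1 / N), ‖trigSum 1 N s‖ₑ ^ q :=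
        setLIntegral_mono' Metric.isClosed_closedBall.measurableSet
          fun s hs => ofReal_le_enorm_trigSum_one hq hN hs
    _ ≤ _ := lintegral_mono_set (closedBall_zero_inv_subset hN)

theorem lintegral_tail_rpow_le {q : ℝ} (hq : 1 < q) {r : ℝ} (hr : 0 < r) :
    ∫⁻ s in (Metric.closedBall (0 : ℝ) r)ᶜ, ENNReal.ofReal ((Real.pi / |s|) ^ q) ≤
      ENNReal.ofReal (2 * Real.pi ^ q / (q - 1) * r ^ (1 - q)) := by
  have hpi := Real.pi_pos
  have hset : (Metric.closedBall (0 : ℝ) r)ᶜ = Set.Iio (-r) ∪ Set.Ioi r := by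
    rw [Real.closedBall_eq_Icc, zero_sub, zero_add]
    ext s
    simp only [Set.mem_compl_iff, Set.mem_Icc, Set.mem_union, Set.mem_Iio, Set.mem_Ioi, not_and_or,
      not_le]
  have hright : ∫⁻ s in Set.Ioi r, ENNReal.ofReal ((Real.pi / |s|) ^ q) =
      ENNReal.ofReal (Real.pi ^ q / (q - 1) * r ^ (1 - q)) := by
    have h1 : ∫⁻ s in Set.Ioi r, ENNReal.ofReal ((Real.pi / |s|) ^ q) =
        ∫⁻ s in Set.Ioi r, ENNReal.ofReal (Real.pi ^ q * s ^ (-q)) := by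
      refine setLIntegral_congr_fun measurableSet_Ioi fun s hs => ?_
      have hs0 : 0 < s := hr.trans hs
      rw [abs_of_pos hs0, Real.div_rpow hpi.le hs0.le, Real.rpow_neg hs0.le, div_eq_mul_inv]
    rw [h1, ← ofReal_integral_eq_lintegral_ofReal]
    · rw [integral_const_mul, integral_Ioi_rpow_of_lt (by linarith) hr]
      congr 1
      rw [show -q + 1 = 1 - q by ring, show 1 - q = -(q - 1) by ring, neg_div_neg_eq]
      ring
    · exact (integrableOn_Ioi_rpow_of_lt (by linarith) hr).const_mul _
    · refine (ae_restrict_mem measurableSet_Ioi).mono fun s hs => ?_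
      have hs0 : 0 < s := hr.trans hs
      positivity
  have hleft : ∫⁻ s in Set.Iio (-r), ENNReal.ofReal ((Real.pi / |s|) ^ q) =
      ∫⁻ s in Set.Ioi r, ENNReal.ofReal ((Real.pi / |s|) ^ q) := by
    have h := (Measure.measurePreserving_neg (volume : Measure ℝ)).setLIntegral_comp_emb
      (MeasurableEquiv.neg ℝ).measurableEmbedding
      (fun s => ENNReal.ofReal ((Real.pi / |s|) ^ q)) (Set.Ioi r)
    rw [Set.image_neg_eq_neg, Set.neg_Ioi] at h
    rw [← h]
    simp only [abs_neg]
  rw [hset]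
  refine (lintegral_union_le _ _ _).trans ?_
  have h0 : 0 ≤ Real.pi ^ q / (q - 1) * r ^ (1 - q) := by
    have : 0 < q - 1 := by linarith
    positivity
  rw [hleft, hright, ← ENNReal.ofReal_add h0 h0]
  refine ENNReal.ofReal_le_ofReal (le_of_eq ?_)
  ring

theorem enorm_trigSum_one_le_of_notMem {q : ℝ} (hq : 0 ≤ q) (N : ℕ) {r s : ℝ} (hr : 0 < r)
    (hs : s ∈ Set.Ico (-Real.pi) Real.pi) (hsr : s ∉ Metric.closedBall (0 : ℝ) r) :
    ‖trigSum 1 N s‖ₑ ^ q ≤ ENNReal.ofReal ((Real.pi / |s|) ^ q) := by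
  rw [mem_closedBall_zero_iff, Real.norm_eq_abs, not_le] at hsr
  rw [enorm_rpow_eq_ofReal hq]
  refine ENNReal.ofReal_le_ofReal (Real.rpow_le_rpow (norm_nonneg _) ?_ hq)
  rw [le_div_iff₀ (hr.trans hsr)]
  exact norm_trigSum_one_mul_abs_le N (abs_le.2 ⟨hs.1, hs.2.le⟩)

/-- Splitting the energy of the Dirichlet kernel at radius `r`, for a weight bounded by `C`. -/
theorem trigEnergy_one_le {q : ℝ} (hq : 1 < q) {w : ℝ → ℝ≥0∞} {C : ℝ≥0} (hC : ∀ᵐ t, w t ≤ C)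
    (N : ℕ) (θ : ℝ) {r : ℝ} (hr : 0 < r) :
    trigEnergy q w 1 N θ ≤ ENNReal.ofReal ((N : ℝ) ^ q) * (∫⁻ t in Metric.closedBall θ r, w t) +
      ENNReal.ofReal (2 * Real.pi ^ q / (q - 1) * r ^ (1 - q)) * C := by
  have hq0 : 0 ≤ q := by linarith
  have hball : MeasurableSet (Metric.closedBall (0 : ℝ) r) :=
    Metric.isClosed_closedBall.measurableSet
  have hshift := measurePreserving_add_right (volume : Measure ℝ) θ
  rw [trigEnergy, ← lintegral_inter_add_sdiff (fun s => ‖trigSum 1 N s‖ₑ ^ q * w (s + θ))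
    (Set.Ico (-Real.pi) Real.pi) hball]
  refine add_le_add ?_ ?_
  · calc ∫⁻ s in Set.Ico (-Real.pi) Real.pi ∩ Metric.closedBall 0 r,
          ‖trigSum 1 N s‖ₑ ^ q * w (s + θ)
        ≤ ∫⁻ s in Metric.closedBall 0 r, ‖trigSum 1 N s‖ₑ ^ q * w (s + θ) :=
          lintegral_mono_set Set.inter_subset_right
      _ ≤ ∫⁻ s in Metric.closedBall 0 r, ENNReal.ofReal ((N : ℝ) ^ q) * w (s + θ) := by
          refine lintegral_mono fun s => ?_
          gcongr
          rw [enorm_rpow_eq_ofReal hq0]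
          exact ENNReal.ofReal_le_ofReal (Real.rpow_le_rpow (norm_nonneg _)
            (norm_trigSum_le (by simp) N s) hq0)
      _ = ENNReal.ofReal ((N : ℝ) ^ q) * ∫⁻ s in Metric.closedBall 0 r, w (s + θ) :=
          lintegral_const_mul' _ _ ENNReal.ofReal_ne_top
      _ = _ := by
          rw [hshift.setLIntegral_comp_emb (measurableEmbedding_addRight θ)]
          congr 3
          rw [Real.closedBall_eq_Icc, Real.closedBall_eq_Icc, Set.image_add_const_Icc]
          congr 1 <;> ring
  · calc ∫⁻ s in Set.Ico (-Real.pi) Real.pi \ Metric.closedBall 0 r,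
          ‖trigSum 1 N s‖ₑ ^ q * w (s + θ)
        ≤ ∫⁻ s in Set.Ico (-Real.pi) Real.pi \ Metric.closedBall 0 r,
            ENNReal.ofReal ((Real.pi / |s|) ^ q) * C := by
          refine lintegral_mono_ae ?_
          filter_upwards [ae_restrict_mem (measurableSet_Ico.diff hball),
            ae_restrict_of_ae (hshift.quasiMeasurePreserving.ae hC)] with s hs hsC
          exact mul_le_mul' (enorm_trigSum_one_le_of_notMem hq0 N hr hs.1 hs.2) hsC
      _ ≤ ∫⁻ s in (Metric.closedBall 0 r)ᶜ, ENNReal.ofReal ((Real.pi / |s|) ^ q) * C :=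
          lintegral_mono_set fun s hs => hs.2
      _ = (∫⁻ s in (Metric.closedBall 0 r)ᶜ, ENNReal.ofReal ((Real.pi / |s|) ^ q)) * C :=
          lintegral_mul_const' _ _ ENNReal.coe_ne_top
      _ ≤ _ := by gcongr; exact lintegral_tail_rpow_le hq hr

/-- The norm of the Dirichlet kernel in the constant weight `1`, split at radius `1 / N`. -/
theorem lintegral_trigSum_one_le {q : ℝ} (hq : 1 < q) {N : ℕ} (hN : 0 < N) :
    ∫⁻ s in Set.Ico (-Real.pi) Real.pi, ‖trigSum 1 N s‖ₑ ^ q ≤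
      ENNReal.ofReal ((2 + 2 * Real.pi ^ q / (q - 1)) * (N : ℝ) ^ (q - 1)) := by
  have hN' : (0 : ℝ) < N := by exact_mod_cast hN
  have hq1 : 0 < q - 1 := by linarith
  have h := trigEnergy_one_le hq (w := fun _ => 1) (C := 1)
    (Eventually.of_forall fun _ => le_rfl) N 0 (r := 1 / N) (by positivity)
  rw [trigEnergy, lintegral_const, one_mul, Measure.restrict_apply_univ, Real.volume_closedBall,
    ← ENNReal.ofReal_mul (by positivity), ENNReal.coe_one, mul_one,
    ← ENNReal.ofReal_add (by positivity) (by positivity)] at h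
  simp only [mul_one] at h
  refine h.trans (ENNReal.ofReal_le_ofReal (le_of_eq ?_))
  rw [one_div, Real.inv_rpow hN'.le, ← Real.rpow_neg hN'.le, neg_sub, Real.rpow_sub_one hN'.ne']
  field_simp

/-! ### The exponent is two -/

theorem le_of_forall_two_pow_rpow_le {a b C : ℝ}
    (h : ∀ m : ℕ, ((2 : ℝ) ^ m) ^ a ≤ C * ((2 : ℝ) ^ m) ^ b) : a ≤ b := by
  by_contra! hba
  obtain ⟨m, hm⟩ := pow_unbounded_of_one_lt C (Real.one_lt_rpow one_lt_two (sub_pos.2 hba))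
  have h1 := h m
  have h2 : (0 : ℝ) < (2 : ℝ) ^ m := by positivity
  rw [← div_le_iff₀ (by positivity), ← Real.rpow_sub h2, ← Real.rpow_natCast, ← Real.rpow_mul
    zero_le_two, mul_comm, Real.rpow_mul zero_le_two, Real.rpow_natCast] at h1
  linarith

/-- If all unimodular polynomials of equal length have comparable `L^q` norms, then `q = 2`: the
norm of the Dirichlet kernel has order `N ^ (1 - 1 / q)`, that of a Rudin–Shapiro polynomial has
order `N ^ (1 / 2)`. -/
theorem eq_two_of_forall_lintegral_trigSum_le {q : ℝ} (hq : 1 < q) {K : ℝ≥0}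
    (h : ∀ (N : ℕ) (ε η : ℕ → ℂ), (∀ n, ‖ε n‖ = 1) → (∀ n, ‖η n‖ = 1) →
      ∫⁻ s in Set.Ico (-Real.pi) Real.pi, ‖trigSum ε N s‖ₑ ^ q ≤
        K * ∫⁻ s in Set.Ico (-Real.pi) Real.pi, ‖trigSum η N s‖ₑ ^ q) : q = 2 := by
  have hq0 : 0 ≤ q := by linarith
  have hq1 : 0 < q - 1 := by linarith
  have hpi := Real.pi_pos
  -- From above: the Dirichlet kernel is no larger than a flat polynomial.
  have hupper : q - 1 ≤ q / 2 := by
    refine le_of_forall_two_pow_rpow_le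
      (C := K * (2 * Real.pi * 2 ^ (q / 2)) * (2 ^ q / 2)) fun m => ?_
    obtain ⟨a, b, ha, hb, hab⟩ := exists_rudinShapiro_pair m
    have h1 := (le_lintegral_trigSum_one hq0 (N := 2 ^ m) (by positivity)).trans
      (h _ 1 a (by simp) ha)
    have h2 := h1.trans (mul_le_mul_right (lintegral_trigSum_le_of_sq_le hq0 (R := 2 ^ (m + 1))
      fun t => by rw [← hab t]; exact le_add_of_nonneg_right (by positivity)) _)
    rw [← ENNReal.ofReal_coe_nnreal, ← ENNReal.ofReal_mul K.coe_nonneg,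
      ENNReal.ofReal_le_ofReal_iff (by positivity), pow_succ,
      Real.mul_rpow (by positivity) (by positivity)] at h2
    push_cast at h2
    have h2m : (0 : ℝ) < 2 ^ m := by positivity
    rw [Real.div_rpow h2m.le zero_le_two] at h2
    rw [Real.rpow_sub_one h2m.ne']
    have h3 : ((2 : ℝ) ^ m) ^ q / 2 ^ m =
        ((2 : ℝ) ^ m) ^ q / 2 ^ q * (2 / 2 ^ m) * (2 ^ q / 2) := by field_simp
    rw [h3]
    calc _ ≤ K * (2 * Real.pi * (((2 : ℝ) ^ m) ^ (q / 2) * 2 ^ (q / 2))) * (2 ^ q / 2) := by gcongr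
      _ = _ := by ring
  -- From below: one of the two flat polynomials is large, and the Dirichlet kernel is no smaller.
  have hlower : q / 2 ≤ q - 1 := by
    refine le_of_forall_two_pow_rpow_le
      (C := K * (2 + 2 * Real.pi ^ q / (q - 1)) / Real.pi) fun m => ?_
    obtain ⟨a, b, ha, hb, hab⟩ := exists_rudinShapiro_pair m
    have h1 := le_lintegral_trigSum_add hq0 (a := a) (b := b) (N := 2 ^ m) (R := 2 ^ m)
      (by positivity) fun t => by rw [hab t, pow_succ, mul_comm]
    have h2 := h1.trans (add_le_add (h _ a 1 ha (by simp)) (h _ b 1 hb (by simp)))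
    have h3 := lintegral_trigSum_one_le hq (N := 2 ^ m) (by positivity)
    have h4 := h2.trans (add_le_add (mul_le_mul_right h3 _) (mul_le_mul_right h3 _))
    rw [← ENNReal.ofReal_coe_nnreal, ← ENNReal.ofReal_mul K.coe_nonneg,
      ← ENNReal.ofReal_add (by positivity) (by positivity),
      ENNReal.ofReal_le_ofReal_iff (by positivity)] at h4
    push_cast at h4
    rw [div_mul_eq_mul_div, le_div_iff₀ hpi]
    linarith
  linarith

/-! ### Bounds on the weight by differentiation -/

/-- Lebesgue differentiation on an open set over which the weight is integrable. -/
theorem ae_tendsto_setLIntegral_closedBall_div {w : ℝ → ℝ≥0∞} (hw : AEMeasurable w) {U : Set ℝ}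
    (hU : IsOpen U) (hfin : ∫⁻ t in U, w t ≠ ∞) {r : ℕ → ℝ} (hr : Tendsto r atTop (𝓝[>] 0)) :
    ∀ᵐ θ, θ ∈ U → Tendsto (fun m => (∫⁻ t in Metric.closedBall θ (r m), w t) /
      volume (Metric.closedBall θ (r m))) atTop (𝓝 (w θ)) := by
  rw [← lintegral_indicator hU.measurableSet] at hfin
  filter_upwards [(Besicovitch.vitaliFamily (volume : Measure ℝ)).ae_tendsto_lintegral_div
    (hw.indicator hU.measurableSet) hfin] with θ hθ hθU
  rw [Set.indicator_of_mem hθU] at hθ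
  refine (hθ.comp ((Besicovitch.tendsto_filterAt volume θ).comp hr)).congr' ?_
  obtain ⟨δ, hδ, hball⟩ := Metric.isOpen_iff.1 hU θ hθU
  have hsmall : ∀ᶠ m in atTop, r m < δ :=
    (tendsto_nhdsWithin_iff.1 hr).1.eventually (gt_mem_nhds hδ)
  filter_upwards [hsmall] with m hm
  simp only [Function.comp_apply]
  congr 1
  refine setLIntegral_congr_fun Metric.isClosed_closedBall.measurableSet fun t ht => ?_
  exact Set.indicator_of_mem (hball (Metric.closedBall_subset_ball hm ht)) w

theorem IsPeriodicWeight.ae_of_ae_Ioo {w : ℝ → ℝ≥0∞} (hw : IsPeriodicWeight w) {P : ℝ≥0∞ → Prop}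
    (h : ∀ᵐ t, t ∈ Set.Ioo (-Real.pi) Real.pi → P (w t)) : ∀ᵐ t, P (w t) := by
  rw [ae_iff]
  have hdom := isAddFundamentalDomain_Ioc Real.two_pi_pos (-Real.pi)
  refine hdom.measure_zero_of_invariant _ ?_ ?_
  · rintro ⟨g, n, rfl⟩
    ext t
    rw [Set.mem_vadd_set_iff_neg_vadd_mem]
    have h1 := hw.periodic.zsmul (-n) t
    rw [neg_smul, add_comm] at h1
    change ¬ P (w (-(n • (2 * Real.pi)) + t)) ↔ ¬ P (w t)
    rw [h1]
  · have hpi : -Real.pi + 2 * Real.pi = Real.pi := by ring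
    rw [hpi, measure_congr ((ae_eq_refl _).inter Ioo_ae_eq_Ioc.symm)]
    rw [ae_iff] at h
    refine measure_mono_null (fun t ht => ?_) h
    exact fun hcon => ht.1 (hcon ht.2)

theorem tendsto_div_two_pow_nhdsGT {R : ℝ} (hR : 0 < R) :
    Tendsto (fun m : ℕ => R / ((2 ^ m : ℕ) : ℝ)) atTop (𝓝[>] 0) := by
  refine tendsto_nhdsWithin_iff.2 ⟨?_, Eventually.of_forall fun m => ?_⟩
  · refine Tendsto.const_div_atTop ?_ R
    push_cast
    exact tendsto_pow_atTop_atTop_of_one_lt one_lt_two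
  · exact div_pos hR (by positivity)

/-- Since `|D_N|² ≥ N² / 4` within `1 / N` of the origin, an upper bound of order `N` for the
translated energies of `D_N` bounds the averages of the weight over intervals of radius `1 / N`. -/
theorem ae_le_of_trigEnergy_le {w : ℝ → ℝ≥0∞} (hw : IsPeriodicWeight w)
    (hfin : ∫⁻ t in Set.Ico (-Real.pi) Real.pi, w t ≠ ∞) {C : ℝ≥0}
    (hC : ∀ (m : ℕ) (θ : ℝ), trigEnergy 2 w 1 (2 ^ m) θ ≤ C * ((2 ^ m : ℕ) : ℝ≥0∞)) :
    ∀ᵐ t, w t ≤ ((2 * C : ℝ≥0) : ℝ≥0∞) := by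
  refine hw.ae_of_ae_Ioo (P := fun x => x ≤ ((2 * C : ℝ≥0) : ℝ≥0∞)) ?_
  filter_upwards [ae_tendsto_setLIntegral_closedBall_div hw.aemeasurable isOpen_Ioo
    (ne_top_of_le_ne_top hfin (lintegral_mono_set Set.Ioo_subset_Ico_self))
    (tendsto_div_two_pow_nhdsGT one_pos)] with θ hθ hmem
  refine le_of_tendsto' (hθ hmem) fun m => ?_
  refine ENNReal.div_le_of_le_mul ?_
  set N : ℕ := 2 ^ m with hN
  have hN0 : 0 < N := by positivity
  have hNr : (0 : ℝ) < N := by exact_mod_cast hN0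
  have hshift := measurePreserving_add_right (volume : Measure ℝ) θ
  have h1 : ENNReal.ofReal ((N / 2 : ℝ) ^ (2 : ℝ)) * (∫⁻ t in Metric.closedBall θ (1 / N), w t) ≤
      trigEnergy 2 w 1 N θ := by
    calc ENNReal.ofReal ((N / 2 : ℝ) ^ (2 : ℝ)) * (∫⁻ t in Metric.closedBall θ (1 / N), w t)
        = ENNReal.ofReal ((N / 2 : ℝ) ^ (2 : ℝ)) *
            ∫⁻ s in Metric.closedBall 0 (1 / N), w (s + θ) := by
          rw [hshift.setLIntegral_comp_emb (measurableEmbedding_addRight θ)]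
          congr 3
          rw [Real.closedBall_eq_Icc, Real.closedBall_eq_Icc, Set.image_add_const_Icc]
          congr 1 <;> ring
      _ = ∫⁻ s in Metric.closedBall 0 (1 / N), ENNReal.ofReal ((N / 2 : ℝ) ^ (2 : ℝ)) * w (s + θ) :=
          (lintegral_const_mul' _ _ ENNReal.ofReal_ne_top).symm
      _ ≤ ∫⁻ s in Metric.closedBall (0 : ℝ) (1 / N), ‖trigSum 1 N s‖ₑ ^ (2 : ℝ) * w (s + θ) :=
          setLIntegral_mono_ae' Metric.isClosed_closedBall.measurableSet
            (Eventually.of_forall fun s hs => by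
              gcongr; exact ofReal_le_enorm_trigSum_one zero_le_two hN0 hs)
      _ ≤ _ := lintegral_mono_set (closedBall_zero_inv_subset hN0)
  have h2 := h1.trans (hC m θ)
  have hpos : 0 < (N / 2 : ℝ) ^ (2 : ℝ) := by positivity
  rw [← ENNReal.mul_le_mul_iff_right (ENNReal.ofReal_pos.2 hpos).ne' ENNReal.ofReal_ne_top]
  refine h2.trans (le_of_eq ?_)
  rw [Real.volume_closedBall, ← ENNReal.ofReal_coe_nnreal, ← ENNReal.ofReal_coe_nnreal,
    ← ENNReal.ofReal_natCast, ← ENNReal.ofReal_mul (by positivity),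
    ← ENNReal.ofReal_mul (by positivity), ← ENNReal.ofReal_mul (by positivity)]
  congr 1
  rw [Real.rpow_two, ← hN]
  push_cast
  field_simp

/-- For a bounded weight, the energy of `D_N` is concentrated within `R / N` of its centre; since
`|D_N|² ≤ N²`, a lower bound of order `N` for the translated energies bounds the averages of the
weight over intervals of radius `R / N` from below. -/
theorem exists_pos_ae_le_of_le_trigEnergy {w : ℝ → ℝ≥0∞} (hw : IsPeriodicWeight w)
    (hfin : ∫⁻ t in Set.Ico (-Real.pi) Real.pi, w t ≠ ∞) {C : ℝ≥0} (hC : ∀ᵐ t, w t ≤ C)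
    {c : ℝ} (hc : 0 < c)
    (hlow : ∀ (m : ℕ) (θ : ℝ), ENNReal.ofReal (c * (2 ^ m : ℕ)) ≤ trigEnergy 2 w 1 (2 ^ m) θ) :
    ∃ d : ℝ, 0 < d ∧ ∀ᵐ t, ENNReal.ofReal d ≤ w t := by
  -- With this `R`, at most half of the energy lies at distance more than `R / N` from the centre.
  obtain ⟨R, hR⟩ : ∃ R : ℝ, R = 4 * Real.pi ^ 2 * (C + 1) / c := ⟨_, rfl⟩
  have hR0 : 0 < R := by rw [hR]; positivity
  refine ⟨c / (4 * R), by positivity, hw.ae_of_ae_Ioo (P := fun x => ENNReal.ofReal _ ≤ x) ?_⟩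
  filter_upwards [ae_tendsto_setLIntegral_closedBall_div hw.aemeasurable isOpen_Ioo
    (ne_top_of_le_ne_top hfin (lintegral_mono_set Set.Ioo_subset_Ico_self))
    (tendsto_div_two_pow_nhdsGT hR0)] with θ hθ hmem
  refine ge_of_tendsto' (hθ hmem) fun m => ?_
  set N : ℕ := 2 ^ m with hN
  have hN0 : 0 < N := by positivity
  have hNr : (0 : ℝ) < N := by exact_mod_cast hN0
  have hr : 0 < R / N := by positivity
  rw [ENNReal.le_div_iff_mul_le (Or.inl (Metric.measure_closedBall_pos _ _ hr).ne')
    (Or.inl measure_closedBall_lt_top.ne), Real.volume_closedBall,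
    ← ENNReal.ofReal_mul (by positivity)]
  have h1 := (hlow m θ).trans (trigEnergy_one_le one_lt_two hC N θ hr)
  have h2 : ENNReal.ofReal (2 * Real.pi ^ (2 : ℝ) / (2 - 1) * (R / N) ^ (1 - 2 : ℝ)) * C ≤
      ENNReal.ofReal (c * N / 2) := by
    rw [← ENNReal.ofReal_coe_nnreal, ← ENNReal.ofReal_mul (by positivity)]
    refine ENNReal.ofReal_le_ofReal ?_
    rw [show (1 - 2 : ℝ) = -1 by norm_num, Real.rpow_neg_one, Real.rpow_two, inv_div, hR]
    have h3 : (2 * Real.pi ^ 2 / (2 - 1) * (N / (4 * Real.pi ^ 2 * (C + 1) / c)) * C : ℝ) =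
        c * N / 2 * (C / (C + 1)) := by
      field_simp
      ring
    rw [h3]
    refine mul_le_of_le_one_right (by positivity) ?_
    rw [div_le_one (by positivity)]
    linarith
  have h3 := h1.trans (add_le_add_right h2 _)
  rw [← hN, ← add_halves (c * N), ENNReal.ofReal_add (by positivity) (by positivity),
    add_halves] at h3
  have h4 := ENNReal.le_of_add_le_add_right ENNReal.ofReal_ne_top h3
  have hpos : 0 < (N : ℝ) ^ (2 : ℝ) := by positivity
  rw [← ENNReal.mul_le_mul_iff_right (ENNReal.ofReal_pos.2 hpos).ne' ENNReal.ofReal_ne_top]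
  refine le_trans (le_of_eq ?_) h4
  rw [← ENNReal.ofReal_mul (by positivity), Real.rpow_two]
  congr 1
  field_simp
  ring

/-- A weight bounded above and below belongs to `A_2`. -/
theorem IsPeriodicWeight.isMuckenhouptWeight_two {w : ℝ → ℝ≥0∞} (hw : IsPeriodicWeight w) {C : ℝ≥0}
    (hC : ∀ᵐ t : ℝ, (C : ℝ≥0∞)⁻¹ ≤ w t ∧ w t ≤ C) : IsMuckenhouptWeight 2 w := by
  refine ⟨hw, C * C, fun a b hab => ?_⟩
  have havg : ∀ f : ℝ → ℝ≥0∞, (∀ᵐ t, f t ≤ C) →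
      (ENNReal.ofReal (b - a))⁻¹ * ∫⁻ t in Set.Ioo a b, f t ≤ C := by
    intro f hf
    have h1 : ∫⁻ t in Set.Ioo a b, f t ≤ C * ENNReal.ofReal (b - a) := by
      rw [← Real.volume_Ioo, ← setLIntegral_const]
      exact lintegral_mono_ae (ae_restrict_of_ae hf)
    rw [mul_comm, ← div_eq_mul_inv]
    exact ENNReal.div_le_of_le_mul h1
  have hexp : -(1 / ((2 : ℝ) - 1)) = -1 := by norm_num
  rw [hexp, show (2 : ℝ) - 1 = 1 by norm_num, ENNReal.rpow_one, ENNReal.coe_mul]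
  refine mul_le_mul' (havg w (hC.mono fun t ht => ht.2)) (havg _ (hC.mono fun t ht => ?_))
  rw [ENNReal.rpow_neg_one]
  exact ENNReal.inv_le_iff_inv_le.1 ht.1

theorem mainTheorem1 (p : ℝ≥0∞) [Fact (1 ≤ p)] (hp : 1 < p) (hp' : p < ∞)
    (w : ℝ → ℝ≥0∞) (hw : IsPeriodicWeight w) (hT : TrigIsQuasiGreedyBasis p w) :
    p = 2 ∧ IsMuckenhouptWeight 2 w ∧
      ∃ C : ℝ≥0, 0 < C ∧ ∀ᵐ t : ℝ, (C : ℝ≥0∞)⁻¹ ≤ w t ∧ w t ≤ C := by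
  obtain ⟨hW0, hWtop⟩ := hT.lintegral_weight hp'.ne hw
  obtain ⟨K, hK⟩ := hT.exists_trigEnergy_le hp'.ne hw
  have hq : 1 < p.toReal := by
    rw [← ENNReal.toReal_one]
    exact (ENNReal.toReal_lt_toReal ENNReal.one_ne_top hp'.ne).2 hp
  have hp2 : p.toReal = 2 := by
    refine eq_two_of_forall_lintegral_trigSum_le hq (K := K) fun N ε η hε hη => ?_
    refine (ENNReal.mul_le_mul_iff_left hW0 hWtop).1 ?_
    rw [mul_assoc, ← lintegral_trigEnergy hw, ← lintegral_trigEnergy hw,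
      ← lintegral_const_mul' _ _ ENNReal.coe_ne_top]
    exact lintegral_mono fun θ => hK N ε η θ θ hε hη
  rw [hp2] at hK
  obtain ⟨W, hW⟩ : ∃ W : ℝ≥0, ∫⁻ t in Set.Ico (-Real.pi) Real.pi, w t = W :=
    ⟨_, (ENNReal.coe_toNNReal hWtop).symm⟩
  have hWpos : (0 : ℝ) < W := by
    rw [hW] at hW0
    exact_mod_cast pos_iff_ne_zero.2 (ENNReal.coe_ne_zero.1 hW0)
  have hup : ∀ (m : ℕ) (θ : ℝ),
      trigEnergy 2 w 1 (2 ^ m) θ ≤ ((2 * K * W : ℝ≥0) : ℝ≥0∞) * ((2 ^ m : ℕ) : ℝ≥0∞) := by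
    intro m θ
    obtain ⟨a, b, ha, -, hab⟩ := exists_rudinShapiro_pair m
    have h1 := trigEnergy_le_of_forall_le hw
      (fun τ => hK (2 ^ m) 1 a θ τ (by simp) ha)
    have h2 := lintegral_trigSum_le_of_sq_le zero_le_two (ε := a) (N := 2 ^ m) (R := 2 ^ (m + 1))
      fun t => by rw [← hab t]; exact le_add_of_nonneg_right (by positivity)
    rw [hW] at h1
    have h3 := h1.trans (mul_le_mul_right (mul_le_mul_left h2 _) _)
    rw [← ENNReal.mul_le_mul_iff_right (ENNReal.ofReal_pos.2 Real.two_pi_pos).ne'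
      ENNReal.ofReal_ne_top]
    refine h3.trans (le_of_eq ?_)
    rw [ENNReal.ofReal_mul Real.two_pi_pos.le, div_self two_ne_zero, Real.rpow_one,
      ENNReal.ofReal_pow zero_le_two, ENNReal.ofReal_ofNat]
    push_cast
    ring
  have hC := ae_le_of_trigEnergy_le hw hWtop hup
  have hlow : ∀ (m : ℕ) (θ : ℝ), ENNReal.ofReal (W / (4 * Real.pi * (K + 1)) * (2 ^ m : ℕ)) ≤
      trigEnergy 2 w 1 (2 ^ m) θ := by
    intro m θ
    have h1 := le_trigEnergy_of_forall_le hw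
      (fun τ => hK (2 ^ m) 1 1 τ θ (by simp) (by simp))
    have h2 := le_lintegral_trigSum_one zero_le_two (N := 2 ^ m) (by positivity)
    rw [hW] at h1
    have h3 := (mul_le_mul_left h2 _).trans h1
    -- `K + 1` is used as a positive denominator.
    have h4 : (K : ℝ≥0∞) ≤ ENNReal.ofReal (K + 1) := by
      rw [← ENNReal.ofReal_coe_nnreal]
      exact ENNReal.ofReal_le_ofReal (by linarith)
    have h5 := h3.trans (mul_le_mul_right (mul_le_mul_left h4 _) _)
    rw [← mul_assoc, ← ENNReal.ofReal_mul (by positivity), ← ENNReal.ofReal_coe_nnreal,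
      ← ENNReal.ofReal_mul (by positivity)] at h5
    have hpos : 0 < 2 * Real.pi * ((K : ℝ) + 1) := by positivity
    rw [← ENNReal.mul_le_mul_iff_right (ENNReal.ofReal_pos.2 hpos).ne' ENNReal.ofReal_ne_top]
    refine le_trans (le_of_eq ?_) h5
    rw [← ENNReal.ofReal_mul (by positivity), Real.rpow_two]
    congr 1
    push_cast
    field_simp
    ring
  obtain ⟨d, hd, hdw⟩ := exists_pos_ae_le_of_le_trigEnergy hw hWtop hC (by positivity) hlow
  have hCd : ∀ᵐ t : ℝ, ((2 * (2 * K * W) + (Real.toNNReal d)⁻¹ : ℝ≥0) : ℝ≥0∞)⁻¹ ≤ w t ∧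
      w t ≤ ((2 * (2 * K * W) + (Real.toNNReal d)⁻¹ : ℝ≥0) : ℝ≥0∞) := by
    filter_upwards [hC, hdw] with t h1 h2
    refine ⟨le_trans ?_ h2, h1.trans (ENNReal.coe_le_coe.2 le_self_add)⟩
    rw [ENNReal.inv_le_iff_inv_le, ENNReal.ofReal, ← ENNReal.coe_inv (Real.toNNReal_pos.2 hd).ne']
    exact ENNReal.coe_le_coe.2 le_add_self
  refine ⟨?_, hw.isMuckenhouptWeight_two hCd, _, ?_, hCd⟩
  · rw [← ENNReal.ofReal_toReal hp'.ne, hp2, ENNReal.ofReal_ofNat]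
  · exact lt_of_lt_of_le (inv_pos.2 (Real.toNNReal_pos.2 hd)) le_add_self
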